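/- Let $d,b\ge 1$ be integers, $M>0$, $x_0\in[0,1]^d$. Observe $Y_i=f(X_i)+\sigma_i\xi_i$, $i=1,\dots,n$, where the $X_i$ are i.i.d. uniform on $[0,1]^d$, the $\xi_i$ are i.i.d., independent of the $X_i$, with a density $g$ that is symmetric and nonincreasing on $[0,\infty)$, and $(\sigma_i)_{i\ge1}$ is a sequence with $\sigma_i\ge\sigma_{\min}>0$, $\sigma_{\min}$ known. Write $\mathbb E_f$ for the expectation and $g_i=g(\cdot/\sigma_i)/\sigma_i$. For $\gamma>0$ let $\rho_\gamma(z)=z^2/2$ if $|z|\le\gamma$ and $\rho_\gamma(z)=\gamma(|z|-\gamma/2)$ otherwise (Huber function), and $c_\gamma=2\int_0^{\gamma\sigma_{\min}}g(z)\,dz$. Fix $\gamma_0>0$ with $c_{\gamma_0}>0$ and assume that $\inf_i\int\rho_{\gamma_0}''(z)g_i(z)\,dz\ge c_{\gamma_0}$. Let $K\ge0$ be a bounded measurable function vanishing outside $[-1/2,1/2]^d$ with $\int K=1$, $K_\infty=\|K\|_\infty$, and assume that for some $h_0>0$ one has $x_0+h_0z\in[0,1]^d$ whenever $K(z)\ne0$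 (automatic if $x_0$ is an interior point of the cube). Let $N_b$ be the number of $p\in\mathbb N^d$ with $|p|=p_1+\dots+p_d\le b$, $U(z)=(z^p)_{|p|\le b}$, and $\lambda$ the smallest eigenvalue of $\int_{[-1/2,1/2]^d}U(x)U(x)^\top K(x)\,dx$. For $h\in(0,1]$ let $V(h)=\prod_j[x_{0,j}-h/2,x_{0,j}+h/2]\cap[0,1]^d$, $f_t(x)=\sum_{|p|\le b}t_p\big(\tfrac{x-x_0}{h}\big)^p\mathbf 1_{V(h)}(x)$, and let $\hat\theta(h)$ be a (measurable) minimizer over $\{t\in\mathbb R^{N_b}:\|t\|_1\le M\}$ of $$t\mapsto\frac1{nh^d}\sum_{i=1}^n\rho_{\gamma_0}\big(Y_i-f_t(X_i)\big)K\Big(\frac{X_i-x_0}{h}\Big).$$ Put $h_{\min}=(\ln n)^{2/d}n^{-1/d}$, $h_{\max}=n^{-1/(2b+d)}$, $h_k=2^{-k}h_{\max}$, let $\mathbf k_n$ be the largest $k$ with $h_k\ge h_{\min}$, $\hat f^{(k)}=\hat\theta_{0,\dots,0}(h_k)$, $S_n(l)=\big[(1+l\ln2)/(nh_l^d)\big]^{1/2}$,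 and for $r\ge1$ $$C=\frac{2N_b}{\lambda\int_0^{\gamma_0\sigma_{\min}}g(z)\,dz}\Big(1+2K_\infty(1\vee\gamma_0)\sqrt{rd}\Big),$$ $$\hat k=\inf\big\{k\le\mathbf k_n:\ |\hat f^{(k)}-\hat f^{(l)}|\le C\,S_n(l),\ l=k+1,\dots,\mathbf k_n\big\},\qquad \hat f^*_{\gamma_0}(x_0)=\hat f^{(\hat k)}.$$ For $\beta,L>0$ let $m$ be the largest integer strictly smaller than $\beta$ and let $\mathbb H_d(\beta,L,M)$ be the set of $f:[0,1]^d\to\mathbb R$ having all partial derivatives up to order $m$ with $|\partial^pf(x)-\partial^pf(y)|\le L\|x-y\|_1^{\beta-m}$ for $|p|=m$, $x,y\in[0,1]^d$, and $\sum_{|p|\le m}\sup_{[0,1]^d}|\partial^pf|\le M$. Let $$\phi_n(\beta)=\Big(\frac{\varrho_n(\beta)}{n}\Big)^{\beta/(2\beta+d)},\qquad \varrho_n(\beta)=1+\frac{2(b-\beta)}{(2\beta+d)(2b+d)}\ln n .$$ Then, for all $\beta\in(0,b]$, $L>0$ and $r\ge1$ (with $\hat f^*_{\gamma_0}$ built from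 the constant $C$ for this $r$), $$\limsup_{n\to\infty}\ \phi_n^{-r}(\beta)\sup_{f\in\mathbb H_d(\beta,L,M)}\mathbb E_f\big|\hat f^*_{\gamma_0}(x_0)-f(x_0)\big|^r<\infty .$$ -/

import Mathlib

open Set Filter Topology MeasureTheory

namespace HuberLepski

noncomputable section

/-! ### Local polynomials -/

/-- The unit cube `[0,1]^d`. -/
def cube (d : ℕ) : Set (Fin d → ℝ) := Icc 0 1

/-- Multi-indices `p ∈ ℕ^d` with `|p| = p_1 + ... + p_d ≤ b`. -/
def multiIdx (d b : ℕ) : Finset (Fin d → ℕ) :=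
  (Fintype.piFinset fun _ : Fin d => Finset.range (b + 1)).filter fun p => ∑ j, p j ≤ b

/-- The number `N_b` of such multi-indices. -/
def numIdx (d b : ℕ) : ℕ := (multiIdx d b).card

lemma zero_mem_multiIdx (d b : ℕ) : (0 : Fin d → ℕ) ∈ multiIdx d b := by
  simp [multiIdx]

/-- Coefficient vectors `t = (t_p)_{|p| ≤ b}`. -/
abbrev Coef (d b : ℕ) : Type := ↥(multiIdx d b) → ℝ

/-- The monomial `z^p = z_1^{p_1} ... z_d^{p_d}`. -/
def monom {d : ℕ} (p : Fin d → ℕ) (z : Fin d → ℝ) : ℝ := ∏ j, z j ^ p j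

/-- The neighbourhood `V_{x₀}(h)`: the cube of side `h` centred at `x₀`, cut by `[0,1]^d`. -/
def nbhd {d : ℕ} (x₀ : Fin d → ℝ) (h : ℝ) : Set (Fin d → ℝ) :=
  (Set.univ.pi fun j => Icc (x₀ j - h / 2) (x₀ j + h / 2)) ∩ cube d

/-- The local polynomial `f_t(x) = ∑_p t_p ((x - x₀)/h)^p` for `x ∈ V_{x₀}(h)`, zero elsewhere. -/
def locPoly {d b : ℕ} (x₀ : Fin d → ℝ) (h : ℝ) (t : Coef d b) : (Fin d → ℝ) → ℝ :=
  (nbhd x₀ h).indicator fun x =>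
    ∑ p : ↥(multiIdx d b), t p * monom p.1 (fun j => (x j - x₀ j) / h)

/-- The parameter set `Θ(M)`, the `ℓ₁`-ball of radius `M`. -/
def paramSet (d b : ℕ) (M : ℝ) : Set (Coef d b) := {t | ∑ p, |t p| ≤ M}

/-! ### Kernel -/

/-- A kernel: a bounded nonnegative function vanishing outside `[-1/2,1/2]^d`, with integral one. -/
structure IsKernel {d : ℕ} (K : (Fin d → ℝ) → ℝ) : Prop where
  measurable : Measurable K
  nonneg : ∀ z, 0 ≤ K z
  support : ∀ z, K z ≠ 0 → ∀ j, z j ∈ Icc (-(1 / 2) : ℝ) (1 / 2)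
  bounded : BddAbove (Set.range K)
  integral_eq_one : ∫ z, K z = 1

/-- The sup-norm `K_∞` of a (bounded) kernel. -/
def kerSup {d : ℕ} (K : (Fin d → ℝ) → ℝ) : ℝ := ⨆ z, |K z|

/-- The matrix `∫_{[-1/2,1/2]^d} U(x) U(x)ᵀ K(x) dx`, where `U(x) = (x^p)_{|p| ≤ b}`. -/
def gram (d b : ℕ) (K : (Fin d → ℝ) → ℝ) : Matrix ↥(multiIdx d b) ↥(multiIdx d b) ℝ :=
  Matrix.of fun p q =>
    ∫ x in Set.univ.pi fun _ : Fin d => Icc (-(1 / 2) : ℝ) (1 / 2),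
      monom p.1 x * monom q.1 x * K x

lemma gram_isHermitian (d b : ℕ) (K : (Fin d → ℝ) → ℝ) : (gram d b K).IsHermitian := by
  ext p q
  simp [gram, mul_comm (monom p.1 _)]

/-- The smallest eigenvalue `λ` of that matrix. -/
def minEig (d b : ℕ) (K : (Fin d → ℝ) → ℝ) : ℝ :=
  ⨅ p, (gram_isHermitian d b K).eigenvalues p

/-! ### Observations -/

/-- Symmetric probability densities on `ℝ` that are monotone (necessarily nonincreasing)
on `[0, ∞)`. -/
structure IsSymmDensity (g : ℝ → ℝ) : Prop where
  measurable : Measurable g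
  nonneg : ∀ z, 0 ≤ g z
  integral_eq_one : ∫ z, g z = 1
  symm : ∀ z, g (-z) = g z
  antitone : AntitoneOn g (Ici 0)

/-- The densities `g_i = g(· / σ_i) / σ_i` of the scaled noise variables `σ_i ξ_i`. -/
def scaledDensity (g : ℝ → ℝ) (σ : ℕ → ℝ) : ℕ → ℝ → ℝ := fun i z => g (z / σ i) / σ i

/-- `c(ρ, (g_i)_i) = inf_i ∫ ρ''(z) g_i(z) dz`. -/
def curvature (ρ : ℝ → ℝ) (g : ℕ → ℝ → ℝ) : ℝ := ⨅ i, ∫ z, deriv (deriv ρ) z * g i z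

/-- The class of sequences of symmetric monotone densities with `c(ρ, (g_i)_i) ≥ c`. -/
def densityClass (ρ : ℝ → ℝ) (c : ℝ) : Set (ℕ → ℝ → ℝ) :=
  {g | (∀ i, IsSymmDensity (g i)) ∧ c ≤ curvature ρ g}

/-- A sample `(X_i, Y_i)_{i < n}`. -/
abbrev Sample (d n : ℕ) : Type := Fin n → (Fin d → ℝ) × ℝ

/-- The law of one observation `(X, f(X) + s ξ)`, where `X` is uniform on `[0,1]^d` and `ξ` is
independent of `X` with density `g`. -/
def obsLawOne {d : ℕ} (g : ℝ → ℝ) (s : ℝ) (f : (Fin d → ℝ) → ℝ) : Measure ((Fin d → ℝ) × ℝ) :=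
  (((volume : Measure (Fin d → ℝ)).restrict (cube d)).prod
    ((volume : Measure ℝ).withDensity fun z => ENNReal.ofReal (g z))).map
      fun w => (w.1, f w.1 + s * w.2)

/-- The law `ℙ_f` of the `n` independent observations `Y_i = f(X_i) + σ_i ξ_i`. -/
def obsLaw {d : ℕ} (g : ℝ → ℝ) (σ : ℕ → ℝ) (f : (Fin d → ℝ) → ℝ) (n : ℕ) :
    Measure (Sample d n) :=
  Measure.pi fun i : Fin n => obsLawOne g (σ i) f

/-! ### Hölder class and maximal risk -/

/-- The largest integer strictly smaller than `β` (for `β > 0`). -/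
def strictFloor (β : ℝ) : ℕ := ⌈β⌉₊ - 1

/-- The isotropic Hölder class. `D p` is the partial derivative `∂^p f` on `[0,1]^d`
(one-sided on the faces). -/
def holderClass (d : ℕ) (β L M : ℝ) : Set ((Fin d → ℝ) → ℝ) :=
  {f | ∃ D : (Fin d → ℕ) → (Fin d → ℝ) → ℝ,
    (∀ x ∈ cube d, D 0 x = f x) ∧
    (∀ p : Fin d → ℕ, ∑ j, p j < strictFloor β → ∀ j, ∀ x ∈ cube d,
      HasDerivWithinAt (fun s => D p (Function.update x j s)) (D (p + Pi.single j 1) x)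
        (Icc 0 1) (x j)) ∧
    (∀ p : Fin d → ℕ, ∑ j, p j = strictFloor β → ∀ x ∈ cube d, ∀ y ∈ cube d,
      |D p x - D p y| ≤ L * (∑ j, |x j - y j|) ^ (β - (strictFloor β : ℝ))) ∧
    ∑ p ∈ multiIdx d (strictFloor β), ⨆ x ∈ cube d, ‖D p x‖ₑ ≤ ENNReal.ofReal M}

/-- The maximal risk `sup_f 𝔼_f |f̃_n(x₀) - f(x₀)|^r` over a class `H` of functions. -/
def maxRisk {d : ℕ} (g : ℝ → ℝ) (σ : ℕ → ℝ) (x₀ : Fin d → ℝ) (r : ℝ) (n : ℕ)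
    (est : Sample d n → ℝ) (H : Set ((Fin d → ℝ) → ℝ)) : ENNReal :=
  ⨆ f ∈ H, ∫⁻ Z, ENNReal.ofReal (|est Z - f x₀| ^ r) ∂(obsLaw g σ f n)

/-! ### The local M-estimator -/

/-- The Huber function. -/
def huber (γ z : ℝ) : ℝ := if |z| ≤ γ then z ^ 2 / 2 else γ * (|z| - γ / 2)

/-- The local criterion
`(n h^d)⁻¹ ∑_i ρ(Y_i - f_t(X_i)) K((X_i - x₀)/h)`. -/
def criterion {d b n : ℕ} (ρ : ℝ → ℝ) (K : (Fin d → ℝ) → ℝ) (x₀ : Fin d → ℝ) (h : ℝ)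
    (Z : Sample d n) (t : Coef d b) : ℝ :=
  1 / ((n : ℝ) * h ^ d) *
    ∑ i, ρ ((Z i).2 - locPoly x₀ h t (Z i).1) * K (fun j => ((Z i).1 j - x₀ j) / h)

/-- `θ` is a (measurable) version of the minimizer of the criterion over `Θ(M)`, for every sample
size `n` and bandwidth `h ∈ (0,1]`. -/
def IsMinimizer {d b : ℕ} (ρ : ℝ → ℝ) (K : (Fin d → ℝ) → ℝ) (x₀ : Fin d → ℝ) (M : ℝ)
    (θ : (n : ℕ) → ℝ → Sample d n → Coef d b) : Prop :=
  ∀ (n : ℕ), ∀ h ∈ Ioc (0 : ℝ) 1, Measurable (θ n h) ∧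
    ∀ Z : Sample d n, θ n h Z ∈ paramSet d b M ∧
      ∀ t ∈ paramSet d b M, criterion ρ K x₀ h Z (θ n h Z) ≤ criterion ρ K x₀ h Z t

/-! ### Bandwidth selection -/

def hMin (d n : ℕ) : ℝ := Real.log n ^ (2 / (d : ℝ)) * (n : ℝ) ^ (-(1 / (d : ℝ)))

def hMax (d b n : ℕ) : ℝ := (n : ℝ) ^ (-(1 / (2 * (b : ℝ) + d)))

/-- The bandwidths `h_k = 2^{-k} h_max`. -/
def bandwidth (d b n k : ℕ) : ℝ := hMax d b n / 2 ^ k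

/-- The largest `k` with `h_k ≥ h_min` (it exists for all large `n`). -/
def lastIdx (d b n : ℕ) : ℕ := sSup {k : ℕ | hMin d n ≤ bandwidth d b n k}

/-- `S_n(l) = ((1 + l ln 2) / (n h_l^d))^{1/2}`. -/
def noiseLevel (d b n l : ℕ) : ℝ :=
  Real.sqrt ((1 + l * Real.log 2) / (n * bandwidth d b n l ^ d))

/-- The estimator `f̂^{(k)}(x₀)`: the constant coefficient at bandwidth `h_k`. -/
def lpa {d b n : ℕ} (θ : (n : ℕ) → ℝ → Sample d n → Coef d b) (k : ℕ) (Z : Sample d n) : ℝ :=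
  θ n (bandwidth d b n k) Z ⟨0, zero_mem_multiIdx d b⟩

/-- Lepski's index `k̂` with threshold constant `C`. -/
def selIdx {d b n : ℕ} (C : ℝ) (θ : (n : ℕ) → ℝ → Sample d n → Coef d b) (Z : Sample d n) : ℕ :=
  sInf {k : ℕ | k ≤ lastIdx d b n ∧ ∀ l, k + 1 ≤ l → l ≤ lastIdx d b n →
    |lpa θ k Z - lpa θ l Z| ≤ C * noiseLevel d b n l}

/-- The selected estimator `f̂^*(x₀) = f̂^{(k̂)}(x₀)`. -/
def lepskiEst {d b : ℕ} (C : ℝ) (θ : (n : ℕ) → ℝ → Sample d n → Coef d b) (n : ℕ)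
    (Z : Sample d n) : ℝ :=
  lpa θ (selIdx C θ Z) Z

/-- `c_γ = 2 ∫_0^{γ σ_min} g(z) dz`. -/
def huberConst (g : ℝ → ℝ) (σmin γ : ℝ) : ℝ := 2 * ∫ z in (0 : ℝ)..(γ * σmin), g z

/-- The threshold constant
`C = 2 N_b / (λ ∫_0^{γ σ_min} g) * (1 + 2 K_∞ (1 ∨ γ) (r d)^{1/2})`. -/
def threshold (d b : ℕ) (K : (Fin d → ℝ) → ℝ) (g : ℝ → ℝ) (σmin γ r : ℝ) : ℝ :=
  2 * (numIdx d b : ℝ) / (minEig d b K * ∫ z in (0 : ℝ)..(γ * σmin), g z) *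
    (1 + 2 * kerSup K * max 1 γ * Real.sqrt (r * d))

/-! ### Adaptive rate -/

/-- The price to pay for adaptation `ϱ_n(β)`. -/
def price (d b n : ℕ) (β : ℝ) : ℝ :=
  1 + 2 * ((b : ℝ) - β) / ((2 * β + d) * (2 * (b : ℝ) + d)) * Real.log n

/-- `φ_n(β) = (ϱ_n(β) / n)^{β / (2β + d)}`. -/
def adaptiveRate (d b n : ℕ) (β : ℝ) : ℝ := (price d b n β / n) ^ (β / (2 * β + d))

end

end HuberLepski

open HuberLepski

/-!
The Huber criterion is a sum of convex functions whose derivatives are truncated residuals. At the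
coefficients of the Taylor polynomial of `f` the score is thus a sum of bounded terms, and since the
noise is symmetric and unimodal, its mean is of the order of the approximation error; Bernstein's
inequality keeps it within a noise level of that mean. The observations whose residual stays in the
quadratic zone of the Huber function already contribute a Hessian that, again by Bernstein, is
close to a multiple of the Gram matrix of the kernel. A convex function with a small gradient at a
point and enough curvature around it has its minimizers nearby, so each local estimator errs by at
most the bias plus half of Lepski's threshold, except with a probability that is exponentially
small in `1 + l ln 2`.

If all estimators from the ideal index on are accurate, Lepski's rule selects an index no larger
than the ideal one, and the comparison inequality transfers the accuracy to the selected estimator.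
Otherwise, if `j` is the last index at which the estimator misses its target, the same argument
applies from `j + 1` on: the error is then of order `S_n(j + 1)`, and these noise levels, weighted
by the exceptional probabilities, sum to the order of `S_n(0)`.
-/

namespace HuberLepski

/-! ### The Huber function -/

/-- The truncation of `a` to `[-γ, γ]`, which is the derivative of the Huber function. -/
def clip (γ a : ℝ) : ℝ := max (-γ) (min γ a)

section Huber

variable {γ : ℝ}

lemma clip_of_abs_le {a : ℝ} (h : |a| ≤ γ) : clip γ a = a := by
  grind [clip]

lemma clip_of_le {a : ℝ} (hγ : 0 ≤ γ) (h : γ ≤ a) : clip γ a = γ := by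
  grind [clip]

lemma clip_of_le_neg {a : ℝ} (hγ : 0 ≤ γ) (h : a ≤ -γ) : clip γ a = -γ := by
  grind [clip]

lemma abs_clip_le (hγ : 0 ≤ γ) (a : ℝ) : |clip γ a| ≤ γ := by
  grind [clip]

lemma clip_neg (hγ : 0 ≤ γ) (a : ℝ) : clip γ (-a) = -clip γ a := by
  grind [clip]

lemma abs_clip_sub_clip_le (γ a b : ℝ) : |clip γ a - clip γ b| ≤ |a - b| := by
  grind [clip]

@[fun_prop]
lemma measurable_clip (γ : ℝ) : Measurable (clip γ) := by
  unfold clip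
  fun_prop

lemma huber_eq_clip (hγ : 0 ≤ γ) (a : ℝ) : huber γ a = clip γ a * a - clip γ a ^ 2 / 2 := by
  unfold huber
  split_ifs with h
  · rw [clip_of_abs_le h]
    ring
  · rcases lt_abs.1 (not_le.1 h) with ha | ha
    · rw [clip_of_le hγ ha.le, abs_of_pos (by linarith)]
      ring
    · rw [clip_of_le_neg hγ (by linarith), abs_of_neg (by linarith)]
      ring

lemma huber_add_clip_mul_le (hγ : 0 ≤ γ) (a b : ℝ) :
    huber γ a + clip γ a * (b - a) ≤ huber γ b := by
  rw [huber_eq_clip hγ, huber_eq_clip hγ]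
  -- `clip γ b` maximizes the concave function `c ↦ c * b - c ^ 2 / 2` over `[-γ, γ]`.
  suffices 0 ≤ (clip γ b - clip γ a) * (2 * b - clip γ a - clip γ b) by nlinarith
  obtain ⟨hl, hu⟩ := abs_le.1 (abs_clip_le hγ a)
  by_cases hb : |b| ≤ γ
  · rw [clip_of_abs_le hb]
    nlinarith [sq_nonneg (b - clip γ a)]
  · rcases lt_abs.1 (not_le.1 hb) with hb | hb
    · rw [clip_of_le hγ hb.le]
      exact mul_nonneg (by linarith) (by linarith)
    · rw [clip_of_le_neg hγ (by linarith)]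
      exact mul_nonneg_of_nonpos_of_nonpos (by linarith) (by linarith)

lemma huber_le_add_clip_mul_add_sq (hγ : 0 ≤ γ) (a b : ℝ) :
    huber γ b ≤ huber γ a + clip γ a * (b - a) + (b - a) ^ 2 := by
  have htangent := huber_add_clip_mul_le hγ b a
  have hlip : (clip γ b - clip γ a) * (b - a) ≤ (b - a) ^ 2 :=
    calc (clip γ b - clip γ a) * (b - a) ≤ |clip γ b - clip γ a| * |b - a| :=
          (le_abs_self _).trans (abs_mul _ _).le
      _ ≤ |b - a| * |b - a| :=
          mul_le_mul_of_nonneg_right (abs_clip_sub_clip_le γ b a) (abs_nonneg _)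
      _ = (b - a) ^ 2 := by rw [abs_mul_abs_self, sq]
  linarith

lemma huber_sub_clip_mul_add_le {ε a s : ℝ} (hγ : 0 ≤ γ) (hs : |s| ≤ ε) :
    huber γ a - clip γ a * s + (if |a| ≤ γ - ε then s ^ 2 / 2 else 0) ≤ huber γ (a - s) := by
  split_ifs with h
  · have ha : |a| ≤ γ := by linarith [abs_nonneg s]
    have has : |a - s| ≤ γ := (abs_sub _ _).trans (by linarith)
    rw [huber, huber, if_pos ha, if_pos has, clip_of_abs_le ha]
    exact le_of_eq (by ring)
  · simpa [sub_eq_add_neg] using huber_add_clip_mul_le hγ a (a - s)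

lemma convexOn_huber (hγ : 0 ≤ γ) : ConvexOn ℝ univ (huber γ) := by
  refine ⟨convex_univ, fun x _ y _ a b ha hb hab => ?_⟩
  have hx := huber_add_clip_mul_le hγ (a * x + b * y) x
  have hy := huber_add_clip_mul_le hγ (a * x + b * y) y
  obtain rfl : b = 1 - a := by linarith
  simp only [smul_eq_mul]
  linarith [mul_le_mul_of_nonneg_left hx ha, mul_le_mul_of_nonneg_left hy hb]

lemma hasDerivAt_huber (hγ : 0 ≤ γ) (a : ℝ) : HasDerivAt (huber γ) (clip γ a) a := by
  rw [hasDerivAt_iff_isLittleO]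
  have hO : (fun x => huber γ x - huber γ a - (x - a) • clip γ a) =O[𝓝 a]
      fun x => (x - a) ^ 2 := by
    refine Asymptotics.IsBigO.of_bound 1 (Eventually.of_forall fun x => ?_)
    have hlower := huber_add_clip_mul_le hγ a x
    have hupper := huber_le_add_clip_mul_add_sq hγ a x
    rw [Real.norm_eq_abs, Real.norm_eq_abs, abs_of_nonneg (sq_nonneg (x - a)), smul_eq_mul, abs_le]
    constructor <;> linarith [sq_nonneg (x - a)]
  refine hO.trans_isLittleO ?_
  simpa using Asymptotics.isLittleO_pow_sub_sub a (m := 2) (by norm_num)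

lemma deriv_deriv_huber (hγ : 0 < γ) {z : ℝ} (hz : |z| ≠ γ) :
    deriv (deriv (huber γ)) z = (Ioo (-γ) γ).indicator 1 z := by
  have hderiv : deriv (huber γ) = clip γ := funext fun a => (hasDerivAt_huber hγ.le a).deriv
  rw [hderiv]
  rcases hz.lt_or_gt with hin | hout
  · have hloc : clip γ =ᶠ[𝓝 z] id := by
      filter_upwards [isOpen_Ioo.mem_nhds (abs_lt.1 hin)] with x hx
      exact clip_of_abs_le (abs_lt.2 hx).le
    rw [indicator_of_mem (s := Ioo (-γ) γ) (abs_lt.1 hin), hloc.deriv_eq, deriv_id, Pi.one_apply]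
  · rw [indicator_of_notMem fun hmem : z ∈ Ioo (-γ) γ => hout.not_gt (abs_lt.2 hmem)]
    rcases lt_abs.1 hout with hz | hz
    · have hloc : clip γ =ᶠ[𝓝 z] fun _ => γ := by
        filter_upwards [isOpen_Ioi.mem_nhds hz] with x hx using clip_of_le hγ.le hx.le
      rw [hloc.deriv_eq, deriv_const]
    · have hloc : clip γ =ᶠ[𝓝 z] fun _ => -γ := by
        filter_upwards [isOpen_Iio.mem_nhds (lt_neg.2 hz)] with x hx
          using clip_of_le_neg hγ.le hx.le
      rw [hloc.deriv_eq, deriv_const]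

end Huber

/-! ### Taylor expansion from coordinatewise derivatives -/

lemma mem_multiIdx {d b : ℕ} {p : Fin d → ℕ} : p ∈ multiIdx d b ↔ ∑ j, p j ≤ b := by
  simp only [multiIdx, Finset.mem_filter, Fintype.mem_piFinset, Finset.mem_range,
    and_iff_right_iff_imp]
  intro hp j
  have := Finset.single_le_sum (f := p) (fun _ _ => Nat.zero_le _) (Finset.mem_univ j)
  omega

lemma multiIdx_mono {d m b : ℕ} (hmb : m ≤ b) : multiIdx d m ⊆ multiIdx d b := fun _ hp =>
  mem_multiIdx.2 ((mem_multiIdx.1 hp).trans hmb)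

lemma sum_add_single {ι : Type*} [Fintype ι] [DecidableEq ι] (p : ι → ℕ) (j : ι) :
    ∑ i, (p + Pi.single j 1 : ι → ℕ) i = ∑ i, p i + 1 := by
  simp [Finset.sum_add_distrib]

lemma sub_single_add_single {ι : Type*} [DecidableEq ι] {p : ι → ℕ} {j : ι} (hj : p j ≠ 0) :
    p - Pi.single j 1 + Pi.single j 1 = p :=
  tsub_add_cancel_of_le fun i => by
    rcases eq_or_ne i j with rfl | hij
    · simpa using Nat.one_le_iff_ne_zero.2 hj
    · simp [Pi.single_eq_of_ne hij]

section Taylor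

variable {d : ℕ}

lemma monom_div (p : Fin d → ℕ) (z : Fin d → ℝ) (h : ℝ) :
    monom p (fun j => z j / h) = monom p z / h ^ ∑ j, p j := by
  simp [monom, div_pow, Finset.prod_div_distrib, Finset.prod_pow_eq_pow_sum]

/-- The divided monomial `z^p / p!`, written as a product over the coordinates so that it can be
differentiated in each of them separately. -/
noncomputable def divMonom (p : Fin d → ℕ) (z : Fin d → ℝ) : ℝ := ∏ j, (z j ^ p j / (p j).factorial)

lemma divMonom_eq_monom_div (p : Fin d → ℕ) (z : Fin d → ℝ) :
    divMonom p z = monom p z / ∏ j, ((p j).factorial : ℝ) := by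
  simp [divMonom, monom, Finset.prod_div_distrib]

lemma divMonom_zero_right {p : Fin d → ℕ} (hp : p ≠ 0) : divMonom p 0 = 0 := by
  obtain ⟨j, hj⟩ := Function.ne_iff.1 hp
  exact Finset.prod_eq_zero (Finset.mem_univ j) (by simp [zero_pow hj])

lemma divMonom_update_sub (p : Fin d → ℕ) (x x₀ : Fin d → ℝ) (j : Fin d) (s : ℝ) :
    divMonom p (Function.update x j s - x₀) =
      (s - x₀ j) ^ p j / (p j).factorial *
        ∏ i ∈ Finset.univ.erase j, ((x i - x₀ i) ^ p i / (p i).factorial) := by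
  rw [divMonom, ← Finset.mul_prod_erase _ _ (Finset.mem_univ j)]
  congr 1
  · simp
  · refine Finset.prod_congr rfl fun i hi => ?_
    simp [Function.update_of_ne (Finset.ne_of_mem_erase hi)]

lemma hasDerivAt_sub_pow_succ_div_factorial (a s : ℝ) (k : ℕ) :
    HasDerivAt (fun s => (s - a) ^ (k + 1) / (k + 1).factorial) ((s - a) ^ k / k.factorial) s := by
  refine ((((hasDerivAt_id s).sub_const a).pow (k + 1)).div_const _).congr_deriv ?_
  have hk : (k.factorial : ℝ) ≠ 0 := by positivity
  simp only [id, Nat.factorial_succ, Nat.cast_mul, Nat.cast_succ, add_tsub_cancel_right, mul_one]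
  field_simp

lemma hasDerivAt_divMonom_add_single (q : Fin d → ℕ) (x x₀ : Fin d → ℝ) (j : Fin d) :
    HasDerivAt (fun s => divMonom (q + Pi.single j 1) (Function.update x j s - x₀))
      (divMonom q (x - x₀)) (x j) := by
  have hoff : ∏ i ∈ Finset.univ.erase j, ((x i - x₀ i) ^ (q + Pi.single j 1 : Fin d → ℕ) i /
        (((q + Pi.single j 1 : Fin d → ℕ) i).factorial : ℝ)) =
      ∏ i ∈ Finset.univ.erase j, ((x i - x₀ i) ^ q i / (q i).factorial) :=
    Finset.prod_congr rfl fun i hi => by simp [Pi.single_eq_of_ne (Finset.ne_of_mem_erase hi)]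
  have hx : divMonom q (x - x₀) = (x j - x₀ j) ^ q j / (q j).factorial *
      ∏ i ∈ Finset.univ.erase j, ((x i - x₀ i) ^ q i / (q i).factorial) := by
    rw [← divMonom_update_sub, Function.update_eq_self]
  simp_rw [divMonom_update_sub, hoff, hx, Pi.add_apply, Pi.single_eq_same]
  exact (hasDerivAt_sub_pow_succ_div_factorial (x₀ j) (x j) (q j)).mul_const _

lemma hasDerivAt_divMonom_of_eq_zero {q : Fin d → ℕ} (x x₀ : Fin d → ℝ) {j : Fin d}
    (hq : q j = 0) :
    HasDerivAt (fun s => divMonom q (Function.update x j s - x₀)) 0 (x j) := by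
  simp_rw [divMonom_update_sub, hq, pow_zero]
  exact hasDerivAt_const _ _

/-- The Taylor polynomial of degree `m` at `x₀` of a function whose partial derivative of
multi-index `p` is `D p`. -/
noncomputable def taylorPoly (D : (Fin d → ℕ) → (Fin d → ℝ) → ℝ) (m : ℕ) (x₀ x : Fin d → ℝ) : ℝ :=
  ∑ p ∈ multiIdx d m, D p x₀ * divMonom p (x - x₀)

lemma taylorPoly_zero (D : (Fin d → ℕ) → (Fin d → ℝ) → ℝ) (x₀ x : Fin d → ℝ) :
    taylorPoly D 0 x₀ x = D 0 x₀ := by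
  have hidx : multiIdx d 0 = {0} := by
    ext p
    simp [mem_multiIdx, funext_iff]
  simp [taylorPoly, hidx, divMonom]

lemma taylorPoly_self (D : (Fin d → ℕ) → (Fin d → ℝ) → ℝ) (m : ℕ) (x₀ : Fin d → ℝ) :
    taylorPoly D m x₀ x₀ = D 0 x₀ := by
  rw [taylorPoly, sub_self, Finset.sum_eq_single 0]
  · simp [divMonom]
  · intro p _ hp
    rw [divMonom_zero_right hp, mul_zero]
  · exact fun h => absurd (zero_mem_multiIdx d m) h

lemma multiIdx_filter_ne_zero (m : ℕ) (j : Fin d) :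
    (multiIdx d (m + 1)).filter (fun p => p j ≠ 0) =
      (multiIdx d m).map (addRightEmbedding (Pi.single j 1)) := by
  ext p
  simp only [Finset.mem_filter, Finset.mem_map, addRightEmbedding_apply, mem_multiIdx]
  constructor
  · rintro ⟨hp, hj⟩
    refine ⟨p - Pi.single j 1, ?_, sub_single_add_single hj⟩
    have := sum_add_single (p - Pi.single j 1) j
    rw [sub_single_add_single hj] at this
    omega
  · rintro ⟨q, hq, rfl⟩
    rw [sum_add_single]
    exact ⟨by omega, by simp⟩

lemma hasDerivAt_taylorPoly (D : (Fin d → ℕ) → (Fin d → ℝ) → ℝ) (m : ℕ) (x₀ x : Fin d → ℝ)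
    (j : Fin d) :
    HasDerivAt (fun s => taylorPoly D (m + 1) x₀ (Function.update x j s))
      (taylorPoly (fun p => D (p + Pi.single j 1)) m x₀ x) (x j) := by
  have hsum : HasDerivAt (fun s => taylorPoly D (m + 1) x₀ (Function.update x j s))
      (∑ p ∈ multiIdx d (m + 1),
        if p j ≠ 0 then D p x₀ * divMonom (p - Pi.single j 1) (x - x₀) else 0) (x j) := by
    refine HasDerivAt.fun_sum fun p _ => ?_
    split_ifs with hp
    · have := (hasDerivAt_divMonom_add_single (p - Pi.single j 1) x x₀ j).const_mul (D p x₀)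
      rwa [sub_single_add_single hp] at this
    · simpa using (hasDerivAt_divMonom_of_eq_zero x x₀ (not_not.1 hp)).const_mul (D p x₀)
  refine hsum.congr_deriv ?_
  rw [← Finset.sum_filter, multiIdx_filter_ne_zero, Finset.sum_map]
  simp [taylorPoly]

end Taylor

lemma mem_uIcc_pi {ι : Type*} {x₀ x y : ι → ℝ} :
    y ∈ uIcc x₀ x ↔ ∀ i, y i ∈ uIcc (x₀ i) (x i) := by
  rw [← pi_univ_uIcc, mem_univ_pi]

lemma piecewise_mem_uIcc {ι : Type*} [DecidableEq ι] (S : Finset ι) (x₀ x : ι → ℝ) :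
    S.piecewise x x₀ ∈ uIcc x₀ x :=
  mem_uIcc_pi.2 fun i => by by_cases hi : i ∈ S <;> simp [hi]

lemma update_mem_uIcc {ι : Type*} [DecidableEq ι] {x₀ x y : ι → ℝ} (hy : y ∈ uIcc x₀ x) {k : ι}
    {s : ℝ} (hs : s ∈ uIcc (x₀ k) (x k)) : Function.update y k s ∈ uIcc x₀ x :=
  mem_uIcc_pi.2 <| (Function.forall_update_iff y fun i t => t ∈ uIcc (x₀ i) (x i)).2
    ⟨hs, fun i _ => mem_uIcc_pi.1 hy i⟩

lemma sum_abs_sub_le_of_mem_uIcc {ι : Type*} [Fintype ι] {x₀ x y : ι → ℝ} (hy : y ∈ uIcc x₀ x) :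
    ∑ i, |y i - x₀ i| ≤ ∑ i, |x i - x₀ i| :=
  Finset.sum_le_sum fun i _ => abs_sub_left_of_mem_uIcc (mem_uIcc_pi.1 hy i)

lemma norm_sub_le_of_hasDerivWithinAt_update {ι E : Type*} [Fintype ι] [DecidableEq ι]
    [NormedAddCommGroup E] [NormedSpace ℝ E] {R : (ι → ℝ) → E} {R' : ι → (ι → ℝ) → E}
    {x₀ x : ι → ℝ} {B : ℝ}
    (hR : ∀ j, ∀ y ∈ uIcc x₀ x, HasDerivWithinAt (fun s => R (Function.update y j s)) (R' j y)
      (uIcc (x₀ j) (x j)) (y j))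
    (hB : ∀ j, ∀ y ∈ uIcc x₀ x, ‖R' j y‖ ≤ B) :
    ‖R x - R x₀‖ ≤ B * ∑ i, |x i - x₀ i| := by
  suffices ∀ S : Finset ι, ‖R (S.piecewise x x₀) - R x₀‖ ≤ B * ∑ i ∈ S, |x i - x₀ i| by
    simpa using this Finset.univ
  intro S
  induction S using Finset.induction_on with
  | empty => simp
  | insert k S hk ih =>
    set y := S.piecewise x x₀ with hy
    have hpath : ∀ s ∈ uIcc (x₀ k) (x k), Function.update y k s ∈ uIcc x₀ x := fun s hs =>
      update_mem_uIcc (piecewise_mem_uIcc S x₀ x) hs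
    have hstep := Convex.norm_image_sub_le_of_norm_hasDerivWithin_le
      (f := fun s => R (Function.update y k s)) (f' := fun s => R' k (Function.update y k s))
      (fun s hs => by simpa using hR k _ (hpath s hs)) (fun s hs => hB k _ (hpath s hs))
      (convex_uIcc _ _) left_mem_uIcc right_mem_uIcc
    have hy₀ : Function.update y k (x₀ k) = y := by
      simp [hy, hk]
    rw [hy₀, Real.norm_eq_abs] at hstep
    rw [Finset.sum_insert hk, mul_add, Finset.piecewise_insert]
    exact (norm_sub_le_norm_sub_add_norm_sub _ _ _).trans (add_le_add hstep ih)

lemma abs_sub_taylorPoly_le {d : ℕ} {L α : ℝ} (hL : 0 ≤ L) (hα : 0 ≤ α) {x₀ : Fin d → ℝ} (m : ℕ)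
    {D : (Fin d → ℕ) → (Fin d → ℝ) → ℝ} {x : Fin d → ℝ}
    (hD : ∀ p : Fin d → ℕ, ∑ j, p j < m → ∀ j, ∀ y ∈ uIcc x₀ x,
      HasDerivWithinAt (fun s => D p (Function.update y j s)) (D (p + Pi.single j 1) y)
        (uIcc (x₀ j) (x j)) (y j))
    (hH : ∀ p : Fin d → ℕ, ∑ j, p j = m → ∀ y ∈ uIcc x₀ x,
      |D p y - D p x₀| ≤ L * (∑ j, |y j - x₀ j|) ^ α) :
    |D 0 x - taylorPoly D m x₀ x| ≤ L * (∑ j, |x j - x₀ j|) ^ (m + α) := by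
  induction m generalizing D x with
  | zero =>
    simpa [taylorPoly_zero] using hH 0 (by simp) x right_mem_uIcc
  | succ m ih =>
    have hmain := norm_sub_le_of_hasDerivWithinAt_update (x₀ := x₀) (x := x)
      (R := fun y => D 0 y - taylorPoly D (m + 1) x₀ y)
      (R' := fun j y => D (Pi.single j 1) y - taylorPoly (fun p => D (p + Pi.single j 1)) m x₀ y)
      (B := L * (∑ j, |x j - x₀ j|) ^ (m + α)) ?_ ?_
    · have hN : 0 ≤ ∑ j, |x j - x₀ j| := Finset.sum_nonneg fun _ _ => abs_nonneg _
      simp only [taylorPoly_self, sub_self, sub_zero, Real.norm_eq_abs] at hmain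
      refine hmain.trans_eq ?_
      rw [mul_assoc, ← Real.rpow_add_one' hN (by positivity), Nat.cast_succ, add_right_comm]
    · intro j y hy
      have hderiv := hD 0 (by simp) j y hy
      rw [zero_add] at hderiv
      exact hderiv.sub (hasDerivAt_taylorPoly D m x₀ y j).hasDerivWithinAt
    · intro j y hy
      have hbox : uIcc x₀ y ⊆ uIcc x₀ x := uIcc_subset_uIcc_left hy
      have hrem := ih (D := fun p => D (p + Pi.single j 1)) (x := y)
        (fun p hp i z hz => by
          have := hD (p + Pi.single j 1) (by rw [sum_add_single]; omega) i z (hbox hz)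
          rw [add_right_comm] at this
          exact this.mono (uIcc_subset_uIcc_left (mem_uIcc_pi.1 hy i)))
        (fun p hp z hz => hH (p + Pi.single j 1) (by rw [sum_add_single, hp]) z (hbox hz))
      rw [zero_add] at hrem
      refine hrem.trans ?_
      have := sum_abs_sub_le_of_mem_uIcc hy
      gcongr

/-- The coefficients, in the coordinates `(x - x₀) / h` of a local polynomial, of the Taylor
polynomial of degree `m` at `x₀`. -/
noncomputable def taylorCoef {d : ℕ} (b : ℕ) (D : (Fin d → ℕ) → (Fin d → ℝ) → ℝ) (m : ℕ)
    (x₀ : Fin d → ℝ) (h : ℝ) : Coef d b :=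
  fun p => if p.1 ∈ multiIdx d m then
    D p x₀ * h ^ (∑ j, p.1 j) / ∏ j, ((p.1 j).factorial : ℝ) else 0

section TaylorCoef

variable {d b m : ℕ} {D : (Fin d → ℕ) → (Fin d → ℝ) → ℝ} {x₀ : Fin d → ℝ} {h : ℝ}

lemma taylorCoef_zero : taylorCoef b D m x₀ h ⟨0, zero_mem_multiIdx d b⟩ = D 0 x₀ := by
  simp [taylorCoef, zero_mem_multiIdx]

lemma abs_mul_pow_div_factorial_le (hh : 0 ≤ h) (hh1 : h ≤ 1) (a : ℝ) (p : Fin d → ℕ) :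
    |a * h ^ (∑ j, p j) / ∏ j, ((p j).factorial : ℝ)| ≤ |a| := by
  have hfact : (1 : ℝ) ≤ ∏ j, ((p j).factorial : ℝ) := by
    exact_mod_cast Finset.prod_pos fun j _ => (p j).factorial_pos
  rw [abs_div, abs_mul, abs_of_nonneg (pow_nonneg hh _), abs_of_pos (zero_lt_one.trans_le hfact)]
  calc |a| * h ^ (∑ j, p j) / ∏ j, ((p j).factorial : ℝ) ≤ |a| * h ^ (∑ j, p j) :=
        div_le_self (by positivity) hfact
    _ ≤ |a| := mul_le_of_le_one_right (abs_nonneg a) (pow_le_one₀ hh hh1)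

lemma taylorCoef_mem_paramSet {M : ℝ} (hh : 0 ≤ h) (hh1 : h ≤ 1) (hmb : m ≤ b)
    (hsum : ∑ p ∈ multiIdx d m, |D p x₀| ≤ M) : taylorCoef b D m x₀ h ∈ paramSet d b M := by
  calc ∑ p, |taylorCoef b D m x₀ h p|
      ≤ ∑ p : ↥(multiIdx d b), if p.1 ∈ multiIdx d m then |D p x₀| else 0 := by
        refine Finset.sum_le_sum fun p _ => ?_
        unfold taylorCoef
        split_ifs
        · exact abs_mul_pow_div_factorial_le hh hh1 _ _
        · rw [abs_zero]
    _ = ∑ p ∈ multiIdx d m, |D p x₀| := by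
        rw [Finset.sum_coe_sort _ fun p => if p ∈ multiIdx d m then |D p x₀| else 0,
          ← Finset.sum_filter, Finset.filter_mem_eq_inter,
          Finset.inter_eq_right.2 (multiIdx_mono hmb)]
    _ ≤ M := hsum

lemma locPoly_taylorCoef (hh : h ≠ 0) (hmb : m ≤ b) {x : Fin d → ℝ} (hx : x ∈ nbhd x₀ h) :
    locPoly x₀ h (taylorCoef b D m x₀ h) x = taylorPoly D m x₀ x := by
  rw [locPoly, indicator_of_mem hx, taylorPoly]
  simp only [taylorCoef, ite_mul, zero_mul]
  rw [Finset.sum_coe_sort (multiIdx d b) fun p => if p ∈ multiIdx d m then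
      D p x₀ * h ^ (∑ j, p j) / (∏ j, ((p j).factorial : ℝ)) * monom p (fun j => (x j - x₀ j) / h)
      else 0, ← Finset.sum_filter, Finset.filter_mem_eq_inter,
    Finset.inter_eq_right.2 (multiIdx_mono hmb)]
  refine Finset.sum_congr rfl fun p _ => ?_
  rw [monom_div p (fun j => x j - x₀ j), divMonom_eq_monom_div,
    show x - x₀ = fun j => x j - x₀ j from rfl]
  field_simp

end TaylorCoef

lemma strictFloor_lt {β : ℝ} (hβ : 0 < β) : (strictFloor β : ℝ) < β :=
  Nat.lt_ceil.1 (Nat.sub_lt (Nat.ceil_pos.2 hβ) one_pos)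

lemma sum_abs_le_of_sum_iSup_enorm_le {ι α : Type*} {s : Finset ι} {A : Set α} {D : ι → α → ℝ}
    {M : ℝ} (hM : 0 ≤ M) (hD : ∑ p ∈ s, ⨆ x ∈ A, ‖D p x‖ₑ ≤ ENNReal.ofReal M) {x : α}
    (hx : x ∈ A) : ∑ p ∈ s, |D p x| ≤ M := by
  have hsum : ∑ p ∈ s, ENNReal.ofReal |D p x| ≤ ENNReal.ofReal M := by
    refine (Finset.sum_le_sum fun p _ => ?_).trans hD
    rw [← Real.enorm_eq_ofReal_abs]
    exact le_iSup₂ (f := fun x (_ : x ∈ A) => ‖D p x‖ₑ) x hx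
  rw [← ENNReal.ofReal_sum_of_nonneg fun _ _ => abs_nonneg _] at hsum
  exact (ENNReal.ofReal_le_ofReal_iff hM).1 hsum

lemma sum_abs_sub_le_of_mem_nbhd {d : ℕ} {x₀ x : Fin d → ℝ} {h : ℝ} (hx : x ∈ nbhd x₀ h) :
    ∑ j, |x j - x₀ j| ≤ d * h / 2 :=
  calc ∑ j, |x j - x₀ j| ≤ ∑ _j : Fin d, h / 2 := Finset.sum_le_sum fun j _ => by
        obtain ⟨hl, hu⟩ := hx.1 j (mem_univ j)
        exact abs_le.2 ⟨by linarith, by linarith⟩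
    _ = d * h / 2 := by simp [mul_div_assoc]

theorem exists_abs_sub_locPoly_le {d b : ℕ} {β L M : ℝ} (hβ : 0 < β) (hβb : β ≤ b) (hL : 0 ≤ L)
    (hM : 0 ≤ M) {x₀ : Fin d → ℝ} (hx₀ : x₀ ∈ cube d) {f : (Fin d → ℝ) → ℝ}
    (hf : f ∈ holderClass d β L M) {h : ℝ} (hh : 0 < h) (hh1 : h ≤ 1) :
    ∃ t ∈ paramSet d b M, t ⟨0, zero_mem_multiIdx d b⟩ = f x₀ ∧
      ∀ x ∈ nbhd x₀ h, |f x - locPoly x₀ h t x| ≤ L * (d * h / 2) ^ β := by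
  obtain ⟨D, hD0, hD, hH, hS⟩ := hf
  have hmβ := strictFloor_lt hβ
  set m := strictFloor β
  have hmb : m ≤ b := by exact_mod_cast (hmβ.trans_le hβb).le
  refine ⟨taylorCoef b D m x₀ h, taylorCoef_mem_paramSet hh.le hh1 hmb
    (sum_abs_le_of_sum_iSup_enorm_le hM hS hx₀), taylorCoef_zero.trans (hD0 x₀ hx₀),
    fun x hx => ?_⟩
  have hbox : uIcc x₀ x ⊆ cube d := uIcc_subset_Icc hx₀ hx.2
  have hside : ∀ j, uIcc (x₀ j) (x j) ⊆ Icc 0 1 := fun j =>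
    ordConnected_Icc.uIcc_subset ⟨hx₀.1 j, hx₀.2 j⟩ ⟨hx.2.1 j, hx.2.2 j⟩
  have hrem := abs_sub_taylorPoly_le hL (sub_pos.2 hmβ).le m
    (fun p hp j y hy => (hD p hp j y (hbox hy)).mono (hside j))
    (fun p hp y hy => hH p hp y (hbox hy) x₀ hx₀)
  rw [add_sub_cancel] at hrem
  rw [locPoly_taylorCoef hh.ne' hmb hx, ← hD0 x hx.2]
  refine hrem.trans ?_
  have := sum_abs_sub_le_of_mem_nbhd hx
  gcongr

/-! ### A Bernstein inequality -/

section Bernstein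

open ProbabilityTheory

variable {Ω : Type*} [MeasurableSpace Ω] {μ : Measure Ω}

lemma mgf_le_exp_sq_mul_integral_sq [IsProbabilityMeasure μ] {X : Ω → ℝ} (hX : AEMeasurable X μ)
    {s : ℝ} (hs : ∀ᵐ ω ∂μ, |s * X ω| ≤ 1) (h0 : μ[X] = 0) :
    mgf X μ s ≤ Real.exp (s ^ 2 * ∫ ω, X ω ^ 2 ∂μ) := by
  have hsX : AEStronglyMeasurable (fun ω => s * X ω) μ := (hX.const_mul s).aestronglyMeasurable
  have hi : Integrable (fun ω => s * X ω) μ := Integrable.of_bound hsX 1 hs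
  have hi2 : Integrable (fun ω => (s * X ω) ^ 2) μ :=
    Integrable.of_bound (hsX.pow 2) 1 (hs.mono fun ω hω => by
      rw [norm_pow]
      exact pow_le_one₀ (norm_nonneg _) hω)
  have hie : Integrable (fun ω => Real.exp (s * X ω)) μ :=
    Integrable.of_bound (Real.continuous_exp.comp_aestronglyMeasurable hsX) (Real.exp 1)
      (hs.mono fun ω hω => by
        rw [Real.norm_eq_abs, Real.abs_exp]
        exact Real.exp_le_exp.2 ((le_abs_self _).trans hω))
  calc mgf X μ s ≤ ∫ ω, (1 + s * X ω + (s * X ω) ^ 2) ∂μ := by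
        refine integral_mono_ae hie (((integrable_const 1).add hi).add hi2) (hs.mono fun ω hω => ?_)
        have := (abs_le.1 (Real.abs_exp_sub_one_sub_id_le hω)).2
        simp only
        linarith
    _ = s ^ 2 * (∫ ω, X ω ^ 2 ∂μ) + 1 := by
        simp_rw [mul_pow] at hi2 ⊢
        rw [integral_add (by fun_prop) hi2, integral_add (integrable_const 1) hi,
          integral_const_mul, integral_const_mul, h0]
        simp [add_comm]
    _ ≤ Real.exp (s ^ 2 * ∫ ω, X ω ^ 2 ∂μ) := Real.add_one_le_exp _

variable {ι : Type*} {X : ι → Ω → ℝ} {t : Finset ι} {B V x : ℝ}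

lemma measureReal_sum_ge_le_exp (hind : iIndepFun X μ) (hX : ∀ i, AEMeasurable (X i) μ)
    (hB : ∀ i ∈ t, ∀ᵐ ω ∂μ, |X i ω| ≤ B) (h0 : ∀ i ∈ t, μ[X i] = 0) (hV : 0 < V)
    (hXV : ∑ i ∈ t, ∫ ω, X i ω ^ 2 ∂μ ≤ V) (hx : 0 ≤ x) (hxB : x * B ≤ 2 * V) :
    μ.real {ω | x ≤ ∑ i ∈ t, X i ω} ≤ Real.exp (-(x ^ 2 / (4 * V))) := by
  have := hind.isProbabilityMeasure
  -- the minimizer of `s ^ 2 * V - s * x`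
  set s : ℝ := x / (2 * V) with hs
  have hs0 : 0 ≤ s := by positivity
  have hbd : ∀ i ∈ t, ∀ᵐ ω ∂μ, |s * X i ω| ≤ 1 := fun i hi => (hB i hi).mono fun ω hω => by
    rw [abs_mul, abs_of_nonneg hs0]
    calc s * |X i ω| ≤ s * B := by gcongr
      _ = x * B / (2 * V) := by rw [hs]; ring
      _ ≤ 1 := (div_le_one (by positivity)).2 hxB
  have hint : Integrable (fun ω => Real.exp (s * (∑ i ∈ t, X i) ω)) μ := by
    refine integrable_exp_mul_of_le s (t.card • B) hs0
      (Finset.aemeasurable_sum t fun i _ => hX i) ?_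
    filter_upwards [(ae_ball_iff t.countable_toSet).2 hB] with ω hω
    rw [Finset.sum_apply]
    exact Finset.sum_le_card_nsmul _ _ _ fun i hi => (le_abs_self _).trans (hω i hi)
  have hmgf : mgf (∑ i ∈ t, X i) μ s ≤ Real.exp (s ^ 2 * V) := by
    rw [hind.mgf_sum₀ hX]
    calc ∏ i ∈ t, mgf (X i) μ s ≤ ∏ i ∈ t, Real.exp (s ^ 2 * ∫ ω, X i ω ^ 2 ∂μ) :=
          Finset.prod_le_prod (fun i _ => mgf_nonneg) fun i hi =>
            mgf_le_exp_sq_mul_integral_sq (hX i) (hbd i hi) (h0 i hi)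
      _ = Real.exp (s ^ 2 * ∑ i ∈ t, ∫ ω, X i ω ^ 2 ∂μ) := by
          rw [← Real.exp_sum, Finset.mul_sum]
      _ ≤ Real.exp (s ^ 2 * V) := by gcongr
  have hchernoff := measure_ge_le_exp_mul_mgf x hs0 hint
  simp only [Finset.sum_apply] at hchernoff
  calc μ.real {ω | x ≤ ∑ i ∈ t, X i ω} ≤ Real.exp (-s * x) * Real.exp (s ^ 2 * V) := by
        exact hchernoff.trans (by gcongr)
    _ = Real.exp (-(x ^ 2 / (4 * V))) := by
        rw [← Real.exp_add, hs]
        congr 1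
        field_simp
        ring

lemma measureReal_abs_sum_ge_le_exp (hind : iIndepFun X μ) (hX : ∀ i, AEMeasurable (X i) μ)
    (hB : ∀ i ∈ t, ∀ᵐ ω ∂μ, |X i ω| ≤ B) (h0 : ∀ i ∈ t, μ[X i] = 0) (hV : 0 < V)
    (hXV : ∑ i ∈ t, ∫ ω, X i ω ^ 2 ∂μ ≤ V) (hx : 0 ≤ x) (hxB : x * B ≤ 2 * V) :
    μ.real {ω | x ≤ |∑ i ∈ t, X i ω|} ≤ 2 * Real.exp (-(x ^ 2 / (4 * V))) := by
  have := hind.isProbabilityMeasure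
  have hneg := measureReal_sum_ge_le_exp (X := fun i ω => -X i ω)
    (hind.comp (fun _ => Neg.neg) fun _ => measurable_neg) (fun i => (hX i).neg)
    (by simpa only [abs_neg] using hB)
    (fun i hi => by rw [integral_neg, h0 i hi, neg_zero]) hV (by simpa only [neg_sq]) hx hxB
  have hunion : {ω | x ≤ |∑ i ∈ t, X i ω|} ⊆
      {ω | x ≤ ∑ i ∈ t, X i ω} ∪ {ω | x ≤ ∑ i ∈ t, -X i ω} := fun ω hω => by
    simpa only [mem_union, mem_ofPred_eq, Finset.sum_neg_distrib] using le_abs.1 hω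
  refine (measureReal_mono hunion).trans ((measureReal_union_le _ _).trans ?_)
  rw [two_mul]
  exact add_le_add (measureReal_sum_ge_le_exp hind hX hB h0 hV hXV hx hxB) hneg

theorem measureReal_pi_abs_sum_sub_integral_ge_le [Fintype ι] {Ω : ι → Type*}
    [∀ i, MeasurableSpace (Ω i)] {μ : ∀ i, Measure (Ω i)} [∀ i, IsProbabilityMeasure (μ i)]
    {W : ∀ i, Ω i → ℝ} (hW : ∀ i, AEMeasurable (W i) (μ i))
    (hB : ∀ i, ∀ᵐ z ∂μ i, |W i z| ≤ B) (hV : 0 < V) (hWV : ∑ i, ∫ z, W i z ^ 2 ∂μ i ≤ V)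
    (hx : 0 ≤ x) (hxB : x * B ≤ V) :
    (Measure.pi μ).real {Z | x ≤ |∑ i, W i (Z i) - ∑ i, ∫ z, W i z ∂μ i|} ≤
      2 * Real.exp (-(x ^ 2 / (4 * V))) := by
  set X : ∀ i, Ω i → ℝ := fun i z => W i z - ∫ z, W i z ∂μ i with hXdef
  have hX : ∀ i, AEMeasurable (X i) (μ i) := fun i => (hW i).sub_const _
  have hX0 : ∀ i, ∫ z, X i z ∂μ i = 0 := fun i => by
    rw [integral_sub (.of_bound (hW i).aestronglyMeasurable B (hB i)) (integrable_const _)]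
    simp
  have hvar : ∀ i, ∫ z, X i z ^ 2 ∂μ i ≤ ∫ z, W i z ^ 2 ∂μ i := fun i => by
    rw [hXdef, ← variance_eq_integral (hW i)]
    exact variance_le_expectation_sq (hW i).aestronglyMeasurable
  have hXB : ∀ i, ∀ᵐ z ∂μ i, |X i z| ≤ 2 * B := fun i => by
    have hmean := norm_integral_le_of_norm_le_const (f := W i) (hB i)
    rw [probReal_univ, mul_one, Real.norm_eq_abs] at hmean
    filter_upwards [hB i] with z hz
    exact (abs_sub _ _).trans (by linarith)
  have := measureReal_abs_sum_ge_le_exp (t := Finset.univ) (iIndepFun_pi hX)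
    (fun i => (hX i).comp_quasiMeasurePreserving (Measure.quasiMeasurePreserving_eval μ i))
    (fun i _ => Measure.tendsto_eval_ae_ae.eventually (hXB i))
    (fun i _ => (integral_comp_eval (hX i).aestronglyMeasurable).trans (hX0 i)) hV
    ((Finset.sum_le_sum fun i _ => (integral_comp_eval
      ((hX i).pow_const 2).aestronglyMeasurable).trans_le (hvar i)).trans hWV) hx (by linarith)
  simpa only [hXdef, Finset.sum_sub_distrib] using this

end Bernstein

/-! ### The Gram matrix of a kernel -/

theorem ae_eval_ne_zero {n : ℕ} {P : MvPolynomial (Fin n) ℝ} (hP : P ≠ 0) :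
    ∀ᵐ x : Fin n → ℝ, MvPolynomial.eval x P ≠ 0 := by
  induction n with
  | zero =>
    obtain ⟨c, rfl⟩ := MvPolynomial.C_surjective (Fin 0) P
    have hc : c ≠ 0 := fun h => hP (by rw [h, MvPolynomial.C_0])
    exact Eventually.of_forall fun x => by rwa [MvPolynomial.eval_C]
  | succ n ih =>
    set Q := MvPolynomial.finSuccEquiv ℝ n P with hQ
    have hQ0 : Q ≠ 0 := by simpa [hQ] using hP
    have hslice : ∀ᵐ y : Fin n → ℝ, ∀ᵐ a : ℝ, MvPolynomial.eval (Fin.cons a y) P ≠ 0 := by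
      filter_upwards [ih (Polynomial.leadingCoeff_ne_zero.2 hQ0)] with y hy
      have hmap : Q.map (MvPolynomial.eval y) ≠ 0 := fun h => hy (by
        simpa using congrArg (Polynomial.coeff · Q.natDegree) h)
      filter_upwards [(Q.map (MvPolynomial.eval y)).roots.toFinset.countable_toSet.ae_notMem
        volume] with a ha
      rw [MvPolynomial.eval_eq_eval_mv_eval']
      simpa [hmap] using ha
    have hmeas : MeasurableSet {z : ℝ × (Fin n → ℝ) |
        MvPolynomial.eval (Fin.cons z.1 z.2 : Fin (n + 1) → ℝ) P ≠ 0} := by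
      have : Continuous fun z : ℝ × (Fin n → ℝ) => (Fin.cons z.1 z.2 : Fin (n + 1) → ℝ) := by
        fun_prop
      exact (isOpen_ne.preimage ((MvPolynomial.continuous_eval P).comp this)).measurableSet
    have hprod := (Measure.ae_prod_iff_ae_ae hmeas).2 ((Measure.ae_ae_comm hmeas).2 hslice)
    filter_upwards [(volume_preserving_piFinSuccAbove (fun _ : Fin (n + 1) => ℝ)
      0).quasiMeasurePreserving.ae hprod] with x hx
    rwa [← Fin.cons_self_tail x]

open scoped MatrixOrder in
lemma iInf_eigenvalues_mul_dotProduct_le {ι : Type*} [Fintype ι] [DecidableEq ι]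
    {A : Matrix ι ι ℝ} (hA : A.IsHermitian) (v : ι → ℝ) :
    (⨅ i, hA.eigenvalues i) * (v ⬝ᵥ v) ≤ v ⬝ᵥ A.mulVec v := by
  have hle : algebraMap ℝ (Matrix ι ι ℝ) (⨅ i, hA.eigenvalues i) ≤ A := by
    refine algebraMap_le_of_le_spectrum (fun x hx => ?_) hA.isSelfAdjoint
    rw [hA.spectrum_real_eq_range_eigenvalues] at hx
    obtain ⟨i, rfl⟩ := hx
    exact ciInf_le (Set.finite_range _).bddBelow i
  have := (Matrix.le_iff.1 hle).dotProduct_mulVec_nonneg v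
  rw [star_trivial, Matrix.sub_mulVec, dotProduct_sub, Algebra.algebraMap_eq_smul_one,
    Matrix.smul_mulVec, Matrix.one_mulVec, dotProduct_smul, smul_eq_mul] at this
  exact sub_nonneg.1 this

variable {d b : ℕ}

/-- The polynomial with coefficient vector `v`: the local polynomial `locPoly` in the rescaled
variable `z = (x - x₀) / h`, without truncation to the neighbourhood. -/
def polyVal (v : Coef d b) (z : Fin d → ℝ) : ℝ := ∑ p, v p * monom p.1 z

lemma ae_polyVal_ne_zero {v : Coef d b} (hv : v ≠ 0) : ∀ᵐ z, polyVal v z ≠ 0 := by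
  let e : ↥(multiIdx d b) → (Fin d →₀ ℕ) := fun p => Finsupp.equivFunOnFinite.symm p.1
  have he : Function.Injective e :=
    Finsupp.equivFunOnFinite.symm.injective.comp Subtype.val_injective
  let P : MvPolynomial (Fin d) ℝ := ∑ p, MvPolynomial.monomial (e p) (v p)
  have hP : P ≠ 0 := by
    obtain ⟨q, hq⟩ := Function.ne_iff.1 hv
    refine fun h => hq ?_
    have hcoeff : MvPolynomial.coeff (e q) P = v q := by
      simp [P, MvPolynomial.coeff_sum, MvPolynomial.coeff_monomial, he.eq_iff]
    rw [← hcoeff, h, MvPolynomial.coeff_zero, Pi.zero_apply]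
  have heval (z : Fin d → ℝ) : MvPolynomial.eval z P = polyVal v z := by
    simp only [P, map_sum, MvPolynomial.eval_monomial, polyVal, monom]
    refine Finset.sum_congr rfl fun p _ => ?_
    rw [Finsupp.prod_fintype _ _ fun _ => pow_zero _]
    rfl
  simpa only [heval] using ae_eval_ne_zero hP

@[fun_prop]
lemma continuous_monom (p : Fin d → ℕ) : Continuous (monom p) := by
  unfold monom; fun_prop

@[fun_prop]
lemma continuous_polyVal (v : Coef d b) : Continuous (polyVal v) := by
  unfold polyVal; fun_prop

lemma abs_monom_le_one (p : Fin d → ℕ) {z : Fin d → ℝ}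
    (hz : ∀ j, z j ∈ Icc (-(1 / 2) : ℝ) (1 / 2)) : |monom p z| ≤ 1 := by
  rw [monom, Finset.abs_prod]
  refine Finset.prod_le_one (fun _ _ => abs_nonneg _) fun j _ => ?_
  rw [abs_pow]
  exact pow_le_one₀ (abs_nonneg _) ((abs_le.2 (hz j)).trans (by norm_num))

lemma abs_polyVal_le (v : Coef d b) {z : Fin d → ℝ}
    (hz : ∀ j, z j ∈ Icc (-(1 / 2) : ℝ) (1 / 2)) : |polyVal v z| ≤ ∑ p, |v p| := by
  refine (Finset.abs_sum_le_sum_abs _ _).trans (Finset.sum_le_sum fun p _ => ?_)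
  rw [abs_mul]
  exact mul_le_of_le_one_right (abs_nonneg _) (abs_monom_le_one p.1 hz)

lemma polyVal_sq_mul (v : Coef d b) (z : Fin d → ℝ) (c : ℝ) :
    polyVal v z ^ 2 * c = ∑ p, ∑ q, v p * v q * (monom p.1 z * monom q.1 z * c) := by
  simp_rw [polyVal, sq, Finset.sum_mul_sum, Finset.sum_mul]
  exact Finset.sum_congr rfl fun p _ => Finset.sum_congr rfl fun q _ => by ring

lemma volume_box : volume (univ.pi fun _ : Fin d => Icc (-(1 / 2) : ℝ) (1 / 2)) = 1 := by
  rw [volume_pi_pi]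
  exact Finset.prod_eq_one fun _ _ => by rw [Real.volume_Icc]; norm_num

namespace IsKernel

variable {K : (Fin d → ℝ) → ℝ} (hK : IsKernel K)
include hK

lemma integrable : Integrable K := integrable_of_integral_eq_one hK.integral_eq_one

lemma abs_le_kerSup (z : Fin d → ℝ) : |K z| ≤ kerSup K := by
  refine le_ciSup (f := fun z => |K z|) ?_ z
  simpa only [abs_of_nonneg (hK.nonneg _)] using hK.bounded

lemma le_kerSup (z : Fin d → ℝ) : K z ≤ kerSup K := (le_abs_self _).trans (hK.abs_le_kerSup z)

lemma eq_zero_of_notMem_box {z : Fin d → ℝ}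
    (hz : z ∉ univ.pi fun _ : Fin d => Icc (-(1 / 2) : ℝ) (1 / 2)) : K z = 0 := by
  by_contra h
  exact hz fun j _ => hK.support z h j

lemma one_le_kerSup : 1 ≤ kerSup K := by
  rw [← hK.integral_eq_one, ← setIntegral_eq_integral_of_forall_compl_eq_zero
    fun z hz => hK.eq_zero_of_notMem_box hz]
  refine (Real.le_norm_self _).trans ((norm_setIntegral_le_of_norm_le_const
    (volume_box.trans_lt ENNReal.one_lt_top) fun z _ => hK.abs_le_kerSup z).trans_eq ?_)
  rw [Measure.real, volume_box, ENNReal.toReal_one, mul_one]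

lemma abs_monom_mul_le (p : Fin d → ℕ) (z : Fin d → ℝ) : |monom p z * K z| ≤ K z := by
  by_cases h : K z = 0
  · simp [h]
  · rw [abs_mul, abs_of_nonneg (hK.nonneg z)]
    exact mul_le_of_le_one_left (hK.nonneg z) (abs_monom_le_one p (hK.support z h))

lemma abs_monom_mul_monom_mul_le (p q : Fin d → ℕ) (z : Fin d → ℝ) :
    |monom p z * monom q z * K z| ≤ K z := by
  by_cases h : K z = 0
  · simp [h]
  · rw [abs_mul, abs_of_nonneg (hK.nonneg z), abs_mul]
    exact mul_le_of_le_one_left (hK.nonneg z) (mul_le_one₀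
      (abs_monom_le_one p (hK.support z h)) (abs_nonneg _) (abs_monom_le_one q (hK.support z h)))

lemma integrable_monom_mul_monom_mul (p q : Fin d → ℕ) :
    Integrable fun z => monom p z * monom q z * K z := by
  have hm := hK.measurable
  exact hK.integrable.mono' (by fun_prop : Measurable _).aestronglyMeasurable
    (Eventually.of_forall (hK.abs_monom_mul_monom_mul_le p q))

lemma integrable_polyVal_sq_mul (v : Coef d b) : Integrable fun z => polyVal v z ^ 2 * K z := by
  simp_rw [polyVal_sq_mul]
  exact integrable_finsetSum _ fun p _ => integrable_finsetSum _ fun q _ =>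
    (hK.integrable_monom_mul_monom_mul p.1 q.1).const_mul _

lemma abs_polyVal_sq_mul_le (v : Coef d b) (z : Fin d → ℝ) :
    |polyVal v z ^ 2 * K z| ≤ (∑ p, |v p|) ^ 2 * kerSup K := by
  rw [abs_mul, abs_pow]
  by_cases h : K z = 0
  · rw [h, abs_zero, mul_zero]
    exact mul_nonneg (sq_nonneg _) (zero_le_one.trans hK.one_le_kerSup)
  · gcongr
    · exact abs_polyVal_le v (hK.support z h)
    · exact hK.abs_le_kerSup z

lemma gram_apply (p q : ↥(multiIdx d b)) :
    gram d b K p q = ∫ z, monom p.1 z * monom q.1 z * K z := by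
  rw [gram, Matrix.of_apply]
  exact setIntegral_eq_integral_of_forall_compl_eq_zero fun z hz => by
    rw [hK.eq_zero_of_notMem_box hz, mul_zero]

lemma dotProduct_gram_mulVec (v : Coef d b) :
    v ⬝ᵥ (gram d b K).mulVec v = ∫ z, polyVal v z ^ 2 * K z := by
  have hint (p q : ↥(multiIdx d b)) :
      Integrable fun z => v p * v q * (monom p.1 z * monom q.1 z * K z) :=
    (hK.integrable_monom_mul_monom_mul p.1 q.1).const_mul _
  simp_rw [polyVal_sq_mul]
  rw [integral_finsetSum _ fun p _ => integrable_finsetSum _ fun q _ => hint p q, dotProduct]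
  refine Finset.sum_congr rfl fun p _ => ?_
  rw [integral_finsetSum _ fun q _ => hint p q, Matrix.mulVec, dotProduct, Finset.mul_sum]
  refine Finset.sum_congr rfl fun q _ => ?_
  rw [integral_const_mul, hK.gram_apply]
  ring

lemma integral_polyVal_sq_mul_pos {v : Coef d b} (hv : v ≠ 0) :
    0 < ∫ z, polyVal v z ^ 2 * K z := by
  have hnonneg : 0 ≤ fun z => polyVal v z ^ 2 * K z :=
    fun z => mul_nonneg (sq_nonneg _) (hK.nonneg z)
  refine (integral_nonneg hnonneg).lt_of_ne fun h => ?_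
  have hae := (integral_eq_zero_iff_of_nonneg hnonneg (hK.integrable_polyVal_sq_mul v)).1 h.symm
  have hK0 : K =ᵐ[volume] 0 := by
    filter_upwards [hae, ae_polyVal_ne_zero hv] with z hz hz'
    exact (mul_eq_zero.1 hz).resolve_left (pow_ne_zero 2 hz')
  exact one_ne_zero (hK.integral_eq_one.symm.trans (integral_eq_zero_of_ae hK0))

lemma minEig_mul_le (v : Coef d b) :
    minEig d b K * ∑ p, v p ^ 2 ≤ ∫ z, polyVal v z ^ 2 * K z := by
  rw [← hK.dotProduct_gram_mulVec, Finset.sum_congr rfl fun p _ => sq (v p)]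
  exact iInf_eigenvalues_mul_dotProduct_le (gram_isHermitian d b K) v

variable (b) in
lemma minEig_pos : 0 < minEig d b K := by
  have hpd : (gram d b K).PosDef :=
    Matrix.PosDef.of_dotProduct_mulVec_pos (gram_isHermitian d b K) fun v hv => by
      rw [star_trivial, hK.dotProduct_gram_mulVec]
      exact hK.integral_polyVal_sq_mul_pos hv
  have : Nonempty ↥(multiIdx d b) := ⟨⟨0, zero_mem_multiIdx d b⟩⟩
  obtain ⟨i, hi⟩ := exists_eq_ciInf_of_finite (f := (gram_isHermitian d b K).eigenvalues)
  rw [minEig, ← hi]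
  exact (gram_isHermitian d b K).posDef_iff_eigenvalues_pos.1 hpd i

end IsKernel

/-! ### The noise -/

/-- The law of the noise variable with density `g`. -/
noncomputable def noiseLaw (g : ℝ → ℝ) : Measure ℝ :=
  volume.withDensity fun z => ENNReal.ofReal (g z)

namespace IsSymmDensity

variable {g : ℝ → ℝ} (hg : IsSymmDensity g)
include hg

lemma integrable : Integrable g := integrable_of_integral_eq_one hg.integral_eq_one

lemma isProbabilityMeasure : IsProbabilityMeasure (noiseLaw g) := by
  refine ⟨?_⟩
  rw [noiseLaw, withDensity_apply _ MeasurableSet.univ, Measure.restrict_univ,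
    ← ofReal_integral_eq_lintegral_ofReal hg.integrable (Eventually.of_forall hg.nonneg),
    hg.integral_eq_one, ENNReal.ofReal_one]

lemma integral_noiseLaw_of_odd {φ : ℝ → ℝ} (hφ : ∀ u, φ (-u) = -φ u) :
    ∫ u, φ u ∂noiseLaw g = 0 := by
  have hdens : ∫ u, φ u ∂noiseLaw g = ∫ u, g u * φ u := by
    rw [noiseLaw, integral_withDensity_eq_integral_toReal_smul hg.measurable.ennreal_ofReal
      (Eventually.of_forall fun _ => ENNReal.ofReal_lt_top)]
    simp only [ENNReal.toReal_ofReal (hg.nonneg _), smul_eq_mul]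
  have hodd := integral_neg_eq_self (fun u => g u * φ u) volume
  simp_rw [hφ, hg.symm, mul_neg, integral_neg] at hodd
  rw [hdens]
  linarith

lemma integral_neg_self (a : ℝ) : ∫ u in (-a)..a, g u = 2 * ∫ u in (0 : ℝ)..a, g u := by
  have hreflect := intervalIntegral.integral_comp_neg (a := 0) (b := a) g
  simp_rw [hg.symm, neg_zero] at hreflect
  rw [← intervalIntegral.integral_add_adjacent_intervals (b := 0)
    hg.integrable.intervalIntegrable hg.integrable.intervalIntegrable, ← hreflect, two_mul]

lemma measureReal_noiseLaw_Icc {a : ℝ} (ha : 0 ≤ a) :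
    (noiseLaw g).real (Icc (-a) a) = 2 * ∫ u in (0 : ℝ)..a, g u := by
  rw [← hg.integral_neg_self, Measure.real, noiseLaw, withDensity_apply _ measurableSet_Icc,
    ← ofReal_integral_eq_lintegral_ofReal hg.integrable.integrableOn
      (Eventually.of_forall hg.nonneg),
    ENNReal.toReal_ofReal (integral_nonneg hg.nonneg), integral_Icc_eq_integral_Ioc,
    intervalIntegral.integral_of_le (neg_le_self ha)]

lemma mul_integral_le {κ a : ℝ} (hκ : 0 < κ) (hκ1 : κ ≤ 1) (ha : 0 ≤ a) :
    κ * ∫ u in (0 : ℝ)..a, g u ≤ ∫ u in (0 : ℝ)..(κ * a), g u := by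
  have hscale := intervalIntegral.mul_integral_comp_mul_left (a := 0) (b := a) (f := g) κ
  rw [mul_zero] at hscale
  rw [← hscale]
  refine mul_le_mul_of_nonneg_left ?_ hκ.le
  refine intervalIntegral.integral_mono_on ha hg.integrable.intervalIntegrable
    (hg.integrable.comp_mul_left' hκ.ne').intervalIntegrable fun u hu => ?_
  exact hg.antitone (mul_nonneg hκ.le hu.1) hu.1 (mul_le_of_le_one_left hu.1 hκ1)

variable {γ : ℝ}

lemma integral_deriv_deriv_huber_mul_scaledDensity (hγ : 0 < γ) {σ : ℕ → ℝ} {i : ℕ}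
    (hσ : 0 < σ i) :
    ∫ z, deriv (deriv (huber γ)) z * scaledDensity g σ i z =
      2 * ∫ u in (0 : ℝ)..(γ / σ i), g u := by
  have hae : ∀ᵐ z : ℝ, |z| ≠ γ := by
    filter_upwards [((toFinite {γ, -γ}).countable.ae_notMem volume)] with z hz h
    exact hz ((abs_eq hγ.le).1 h)
  calc ∫ z, deriv (deriv (huber γ)) z * scaledDensity g σ i z
      = ∫ z, (Ioo (-γ) γ).indicator (fun z => g (z / σ i) / σ i) z := by
        refine integral_congr_ae ?_
        filter_upwards [hae] with z hz
        rw [deriv_deriv_huber hγ hz]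
        by_cases hm : z ∈ Ioo (-γ) γ <;> simp [hm, scaledDensity]
    _ = ∫ z in (-γ)..γ, g (z / σ i) / σ i := by
        rw [integral_indicator measurableSet_Ioo, ← integral_Ioc_eq_integral_Ioo,
          ← intervalIntegral.integral_of_le (by linarith)]
    _ = ∫ u in (-(γ / σ i))..(γ / σ i), g u := by
        rw [intervalIntegral.integral_div, intervalIntegral.integral_comp_div _ hσ.ne',
          smul_eq_mul, mul_div_cancel_left₀ _ hσ.ne', neg_div]
    _ = 2 * ∫ u in (0 : ℝ)..(γ / σ i), g u := hg.integral_neg_self _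

lemma le_integral_of_scaledDensity_mem_densityClass (hγ : 0 < γ) {σ : ℕ → ℝ}
    (hσ : ∀ i, 0 < σ i) {c : ℝ} (hG : scaledDensity g σ ∈ densityClass (huber γ) c) (i : ℕ) :
    c ≤ 2 * ∫ u in (0 : ℝ)..(γ / σ i), g u := by
  have hval j := hg.integral_deriv_deriv_huber_mul_scaledDensity hγ (hσ j)
  rw [← hval]
  refine hG.2.trans (ciInf_le ⟨0, ?_⟩ i)
  rintro _ ⟨j, rfl⟩
  simp only [hval]
  exact mul_nonneg zero_le_two (intervalIntegral.integral_nonneg (div_pos hγ (hσ j)).le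
    fun u _ => hg.nonneg u)

lemma le_measureReal_abs_add_le {s c a : ℝ} (hs : 0 < s) (hγ : 0 < γ)
    (hc : c ≤ 2 * ∫ u in (0 : ℝ)..(γ / s), g u) (ha : |a| ≤ γ / 16) :
    7 / 8 * c ≤ (noiseLaw g).real {u | |a + s * u| ≤ γ - γ / 16} := by
  have := hg.isProbabilityMeasure
  have hshrink := hg.mul_integral_le (κ := 7 / 8) (a := γ / s) (by norm_num) (by norm_num)
    (by positivity)
  calc 7 / 8 * c ≤ 2 * ∫ u in (0 : ℝ)..(7 / 8 * (γ / s)), g u := by linarith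
    _ = (noiseLaw g).real (Icc (-(7 / 8 * (γ / s))) (7 / 8 * (γ / s))) :=
        (hg.measureReal_noiseLaw_Icc (by positivity)).symm
    _ ≤ _ := by
        refine measureReal_mono fun u hu => ?_
        have hsu : |s * u| ≤ 7 / 8 * γ := by
          rw [abs_mul, abs_of_pos hs]
          calc s * |u| ≤ s * (7 / 8 * (γ / s)) := by gcongr; exact abs_le.2 hu
            _ = 7 / 8 * γ := by field_simp
        exact (abs_add_le a (s * u)).trans (by linarith)

lemma abs_integral_clip_add_le (hγ : 0 ≤ γ) (a s : ℝ) :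
    |∫ u, clip γ (a + s * u) ∂noiseLaw g| ≤ |a| := by
  have := hg.isProbabilityMeasure
  have hint (a : ℝ) : Integrable (fun u => clip γ (a + s * u)) (noiseLaw g) :=
    Integrable.of_bound (by fun_prop : Measurable _).aestronglyMeasurable γ
      (Eventually.of_forall fun u => abs_clip_le hγ _)
  have hzero : ∫ u, clip γ (0 + s * u) ∂noiseLaw g = 0 :=
    hg.integral_noiseLaw_of_odd fun u => by rw [zero_add, zero_add, mul_neg, clip_neg hγ]
  have hcenter : ∫ u, clip γ (a + s * u) ∂noiseLaw g =
      ∫ u, clip γ (a + s * u) - clip γ (0 + s * u) ∂noiseLaw g := by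
    rw [integral_sub (hint a) (hint 0), hzero, sub_zero]
  rw [hcenter]
  have hle (u : ℝ) : ‖clip γ (a + s * u) - clip γ (0 + s * u)‖ ≤ |a| := by
    simpa only [zero_add, add_sub_cancel_right, Real.norm_eq_abs] using
      abs_clip_sub_clip_le γ (a + s * u) (0 + s * u)
  simpa only [probReal_univ, mul_one, Real.norm_eq_abs] using
    norm_integral_le_of_norm_le_const (μ := noiseLaw g) (Eventually.of_forall hle)

end IsSymmDensity

/-! ### Rescaling -/

variable {d b : ℕ} {x₀ : Fin d → ℝ} {h : ℝ}

lemma measurableSet_cube (d : ℕ) : MeasurableSet (cube d) := measurableSet_Icc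

lemma isProbabilityMeasure_restrict_cube (d : ℕ) :
    IsProbabilityMeasure ((volume : Measure (Fin d → ℝ)).restrict (cube d)) :=
  ⟨by simp [cube, Real.volume_Icc_pi]⟩

lemma measurableSet_nbhd (x₀ : Fin d → ℝ) (h : ℝ) : MeasurableSet (nbhd x₀ h) :=
  (MeasurableSet.univ_pi fun _ => measurableSet_Icc).inter (measurableSet_cube d)

/-- The rescaled design point `(x - x₀) / h`. -/
noncomputable def resc (x₀ : Fin d → ℝ) (h : ℝ) (x : Fin d → ℝ) : Fin d → ℝ :=
  fun j => (x j - x₀ j) / h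

@[fun_prop]
lemma continuous_resc (x₀ : Fin d → ℝ) (h : ℝ) : Continuous (resc x₀ h) := by
  unfold resc; fun_prop

lemma resc_eq_smul (x₀ : Fin d → ℝ) (h : ℝ) (x : Fin d → ℝ) : resc x₀ h x = h⁻¹ • (x - x₀) :=
  funext fun _ => div_eq_inv_mul _ _

lemma add_smul_resc (x₀ : Fin d → ℝ) (hh : h ≠ 0) (x : Fin d → ℝ) :
    x₀ + h • resc x₀ h x = x := by
  rw [resc_eq_smul, smul_inv_smul₀ hh, add_sub_cancel]

lemma locPoly_of_mem_nbhd {t : Coef d b} {x : Fin d → ℝ} (hx : x ∈ nbhd x₀ h) :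
    locPoly x₀ h t x = polyVal t (resc x₀ h x) := indicator_of_mem hx _

@[fun_prop]
lemma measurable_locPoly (x₀ : Fin d → ℝ) (h : ℝ) (t : Coef d b) :
    Measurable (locPoly x₀ h t) :=
  ((continuous_polyVal t).comp (continuous_resc x₀ h)).measurable.indicator
    (measurableSet_nbhd x₀ h)

lemma nbhd_mem_nhdsWithin (x₀ : Fin d → ℝ) (hh : 0 < h) : nbhd x₀ h ∈ 𝓝[cube d] x₀ :=
  inter_mem (mem_nhdsWithin_of_mem_nhds (set_pi_mem_nhds finite_univ fun _ _ =>
    Icc_mem_nhds (by linarith) (by linarith))) self_mem_nhdsWithin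

lemma continuousOn_of_mem_holderClass {β L M : ℝ} (hβ : 0 < β) (hL : 0 ≤ L) (hM : 0 ≤ M)
    {f : (Fin d → ℝ) → ℝ} (hf : f ∈ holderClass d β L M) : ContinuousOn f (cube d) := by
  intro x₀ hx₀
  refine continuousWithinAt_of_locally_uniform_approx_of_continuousWithinAt hx₀ fun u hu => ?_
  obtain ⟨ε, hε, hεu⟩ := Metric.mem_uniformity_dist.1 hu
  have hlim : Tendsto (fun h : ℝ => L * (d * h / 2) ^ β) (𝓝[>] 0) (𝓝 0) := by
    have : Continuous fun h : ℝ => L * (d * h / 2) ^ β :=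
      continuous_const.mul ((by fun_prop : Continuous fun h : ℝ => d * h / 2).rpow_const
        fun _ => Or.inr hβ.le)
    simpa [Real.zero_rpow hβ.ne'] using (this.tendsto 0).mono_left nhdsWithin_le_nhds
  obtain ⟨h, hhε, hh⟩ :=
    ((hlim.eventually_lt_const hε).and (Ioc_mem_nhdsGT one_pos)).exists
  obtain ⟨t, -, -, ht⟩ := exists_abs_sub_locPoly_le (b := ⌈β⌉₊) hβ (Nat.le_ceil β) hL hM hx₀ hf
    hh.1 hh.2
  refine ⟨nbhd x₀ h, nbhd_mem_nhdsWithin x₀ hh.1, fun x => polyVal t (resc x₀ h x),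
    (by fun_prop : Continuous _).continuousWithinAt, fun x hx => hεu ?_⟩
  have := ht x hx
  rw [locPoly_of_mem_nbhd hx] at this
  exact this.trans_lt hhε

variable {K : (Fin d → ℝ) → ℝ}

lemma mem_nbhd_of_ne_zero (hK : IsKernel K) (hh : 0 < h)
    (hKh : ∀ z, K z ≠ 0 → x₀ + h • z ∈ cube d) {x : Fin d → ℝ} (hx : K (resc x₀ h x) ≠ 0) :
    x ∈ nbhd x₀ h := by
  refine ⟨fun j _ => ?_, by simpa only [add_smul_resc x₀ hh.ne'] using hKh _ hx⟩
  have hj := hK.support _ hx j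
  rw [resc, mem_Icc, le_div_iff₀ hh, div_le_iff₀ hh] at hj
  constructor <;> linarith [hj.1, hj.2]

lemma integrable_comp_resc (x₀ : Fin d → ℝ) (hh : h ≠ 0) {φ : (Fin d → ℝ) → ℝ}
    (hφ : Integrable φ) : Integrable fun x => φ (resc x₀ h x) := by
  simp_rw [resc_eq_smul]
  exact (hφ.comp_smul (inv_ne_zero hh)).comp_sub_right x₀

lemma setIntegral_cube_comp_resc (hh : 0 < h) (hKh : ∀ z, K z ≠ 0 → x₀ + h • z ∈ cube d)
    {φ : (Fin d → ℝ) → ℝ} (hφ : ∀ z, K z = 0 → φ z = 0) :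
    ∫ x in cube d, φ (resc x₀ h x) = h ^ d * ∫ z, φ z := by
  rw [setIntegral_eq_integral_of_forall_compl_eq_zero]
  · simp_rw [resc_eq_smul]
    rw [integral_sub_right_eq_self (fun x => φ (h⁻¹ • x)) x₀,
      Measure.integral_comp_inv_smul_of_nonneg _ _ hh.le, Module.finrank_fin_fun, smul_eq_mul]
  · intro x hx
    refine hφ _ (by_contra fun hn => hx ?_)
    simpa only [add_smul_resc x₀ hh.ne'] using hKh _ hn

/-! ### The law of one observation -/

section OneObservation

variable {g : ℝ → ℝ} {f : (Fin d → ℝ) → ℝ} {s : ℝ}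

lemma aemeasurable_observation (hf : AEMeasurable f (volume.restrict (cube d))) (g : ℝ → ℝ)
    (s : ℝ) : AEMeasurable (fun w : (Fin d → ℝ) × ℝ => (w.1, f w.1 + s * w.2))
      ((volume.restrict (cube d)).prod (noiseLaw g)) :=
  measurable_fst.aemeasurable.prodMk
    (hf.comp_fst.add (measurable_snd.const_mul s).aemeasurable)

lemma obsLawOne_eq_map (g : ℝ → ℝ) (s : ℝ) (f : (Fin d → ℝ) → ℝ) :
    obsLawOne g s f = ((volume.restrict (cube d)).prod (noiseLaw g)).map
      fun w => (w.1, f w.1 + s * w.2) := rfl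

variable (hg : IsSymmDensity g) (hf : AEMeasurable f (volume.restrict (cube d)))
include hg hf

lemma isProbabilityMeasure_obsLawOne (s : ℝ) : IsProbabilityMeasure (obsLawOne g s f) := by
  have := hg.isProbabilityMeasure
  have := isProbabilityMeasure_restrict_cube d
  rw [obsLawOne_eq_map]
  exact Measure.isProbabilityMeasure_map (aemeasurable_observation hf g s)

variable {Φ : (Fin d → ℝ) × ℝ → ℝ} (hΦ : Measurable Φ) {B : ℝ} (hB : ∀ z, |Φ z| ≤ B)
include hΦ hB

lemma integrable_comp_observation (s : ℝ) : Integrable (fun w => Φ (w.1, f w.1 + s * w.2))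
    ((volume.restrict (cube d)).prod (noiseLaw g)) := by
  have := hg.isProbabilityMeasure
  have := isProbabilityMeasure_restrict_cube d
  exact Integrable.of_bound
    (hΦ.comp_aemeasurable (aemeasurable_observation hf g s)).aestronglyMeasurable B
    (Eventually.of_forall fun w => hB _)

lemma integral_obsLawOne (s : ℝ) :
    ∫ z, Φ z ∂obsLawOne g s f = ∫ x in cube d, ∫ u, Φ (x, f x + s * u) ∂noiseLaw g := by
  have := hg.isProbabilityMeasure
  rw [obsLawOne_eq_map, integral_map (aemeasurable_observation hf g s) hΦ.aestronglyMeasurable]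
  exact integral_prod _ (integrable_comp_observation hg hf hΦ hB s)

end OneObservation

/-! ### Score and curvature of the local criterion -/

section Moments

variable {γ : ℝ} {t : Coef d b}

/-- The `p`-th component of the score of the local criterion at `t`, for one observation. -/
noncomputable def score (γ : ℝ) (K : (Fin d → ℝ) → ℝ) (x₀ : Fin d → ℝ) (h : ℝ) (t : Coef d b)
    (p : ↥(multiIdx d b)) (z : (Fin d → ℝ) × ℝ) : ℝ :=
  clip γ (z.2 - locPoly x₀ h t z.1) * (monom p.1 (resc x₀ h z.1) * K (resc x₀ h z.1))

/-- The observations whose residuals at `t` stay in the quadratic zone `[-γ, γ]` of the Huber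
function when the local polynomial moves by at most `γ / 16`. -/
def quadZone (γ : ℝ) (x₀ : Fin d → ℝ) (h : ℝ) (t : Coef d b) : Set ((Fin d → ℝ) × ℝ) :=
  {z | |z.2 - locPoly x₀ h t z.1| ≤ γ - γ / 16}

/-- The `(p, q)`-th entry of the Hessian of the local criterion at `t`, for one observation;
only observations in `quadZone` are counted. -/
noncomputable def hess (γ : ℝ) (K : (Fin d → ℝ) → ℝ) (x₀ : Fin d → ℝ) (h : ℝ) (t : Coef d b)
    (p q : ↥(multiIdx d b)) : (Fin d → ℝ) × ℝ → ℝ :=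
  (quadZone γ x₀ h t).indicator fun z =>
    monom p.1 (resc x₀ h z.1) * monom q.1 (resc x₀ h z.1) * K (resc x₀ h z.1)

lemma sum_mul_score (w : Coef d b) (z : (Fin d → ℝ) × ℝ) :
    ∑ p, w p * score γ K x₀ h t p z =
      clip γ (z.2 - locPoly x₀ h t z.1) * polyVal w (resc x₀ h z.1) * K (resc x₀ h z.1) := by
  rw [polyVal, Finset.mul_sum, Finset.sum_mul]
  exact Finset.sum_congr rfl fun p _ => by rw [score]; ring

lemma sum_mul_hess (w : Coef d b) (z : (Fin d → ℝ) × ℝ) :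
    ∑ p, ∑ q, w p * w q * hess γ K x₀ h t p q z = (quadZone γ x₀ h t).indicator
      (fun z => polyVal w (resc x₀ h z.1) ^ 2 * K (resc x₀ h z.1)) z := by
  by_cases hz : z ∈ quadZone γ x₀ h t
  · simp only [hess, indicator_of_mem hz, polyVal_sq_mul]
  · simp only [hess, indicator_of_notMem hz, mul_zero, Finset.sum_const_zero]

lemma measurableSet_quadZone (γ : ℝ) (x₀ : Fin d → ℝ) (h : ℝ) (t : Coef d b) :
    MeasurableSet (quadZone γ x₀ h t) :=
  measurableSet_le (by fun_prop) measurable_const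

variable (hK : IsKernel K)
include hK

lemma measurable_score (p : ↥(multiIdx d b)) : Measurable (score γ K x₀ h t p) := by
  have := hK.measurable
  unfold score; fun_prop

lemma measurable_hess (p q : ↥(multiIdx d b)) : Measurable (hess γ K x₀ h t p q) := by
  have := hK.measurable
  exact Measurable.indicator (by fun_prop) (measurableSet_quadZone γ x₀ h t)

lemma abs_score_le (hγ : 0 ≤ γ) (p : ↥(multiIdx d b)) (z : (Fin d → ℝ) × ℝ) :
    |score γ K x₀ h t p z| ≤ γ * K (resc x₀ h z.1) := by
  rw [score, abs_mul]
  exact mul_le_mul (abs_clip_le hγ _) (hK.abs_monom_mul_le p.1 _) (abs_nonneg _) hγ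

lemma abs_hess_le (p q : ↥(multiIdx d b)) (z : (Fin d → ℝ) × ℝ) :
    |hess γ K x₀ h t p q z| ≤ K (resc x₀ h z.1) := by
  rw [hess, ← Real.norm_eq_abs, norm_indicator_eq_indicator_norm]
  exact indicator_le' (fun z _ => hK.abs_monom_mul_monom_mul_le p.1 q.1 _)
    (fun z _ => hK.nonneg _) z

variable {g : ℝ → ℝ} (hg : IsSymmDensity g) {f : (Fin d → ℝ) → ℝ}
  (hf : AEMeasurable f (volume.restrict (cube d)))
include hg hf

lemma sum_mul_integral_hess (w : Coef d b) (s : ℝ) :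
    ∑ p, ∑ q, w p * w q * ∫ z, hess γ K x₀ h t p q z ∂obsLawOne g s f =
      ∫ z, (quadZone γ x₀ h t).indicator
        (fun z => polyVal w (resc x₀ h z.1) ^ 2 * K (resc x₀ h z.1)) z ∂obsLawOne g s f := by
  have := isProbabilityMeasure_obsLawOne hg hf s
  have hint (p q : ↥(multiIdx d b)) :
      Integrable (fun z => w p * w q * hess γ K x₀ h t p q z) (obsLawOne g s f) :=
    (Integrable.of_bound (measurable_hess hK p q).aestronglyMeasurable (kerSup K)
      (Eventually.of_forall fun z => (abs_hess_le hK p q z).trans (hK.le_kerSup _))).const_mul _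
  simp_rw [← sum_mul_hess]
  rw [integral_finsetSum _ fun p _ => integrable_finsetSum _ fun q _ => hint p q]
  refine Finset.sum_congr rfl fun p _ => ?_
  rw [integral_finsetSum _ fun q _ => hint p q]
  exact Finset.sum_congr rfl fun q _ => (integral_const_mul _ _).symm

variable (hh : 0 < h) (hKh : ∀ z, K z ≠ 0 → x₀ + h • z ∈ cube d)
include hh hKh

lemma integral_sq_obsLawOne_le {Φ : (Fin d → ℝ) × ℝ → ℝ} {B : ℝ}
    (hB : ∀ z, |Φ z| ≤ B * K (resc x₀ h z.1)) (s : ℝ) :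
    ∫ z, Φ z ^ 2 ∂obsLawOne g s f ≤ B ^ 2 * kerSup K * h ^ d := by
  have := hg.isProbabilityMeasure
  have := isProbabilityMeasure_obsLawOne hg hf s
  have hKm := hK.measurable
  have hKn := hK.nonneg
  have hKint : Integrable (fun z : (Fin d → ℝ) × ℝ => K (resc x₀ h z.1)) (obsLawOne g s f) :=
    Integrable.of_bound (by fun_prop : Measurable _).aestronglyMeasurable (kerSup K)
      (Eventually.of_forall fun z => hK.abs_le_kerSup _)
  calc ∫ z, Φ z ^ 2 ∂obsLawOne g s f
      ≤ ∫ z, B ^ 2 * kerSup K * K (resc x₀ h z.1) ∂obsLawOne g s f := by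
        refine integral_mono_of_nonneg (Eventually.of_forall fun z => sq_nonneg _)
          (hKint.const_mul _) (Eventually.of_forall fun z => ?_)
        calc Φ z ^ 2 = |Φ z| ^ 2 := (sq_abs _).symm
          _ ≤ (B * K (resc x₀ h z.1)) ^ 2 := by gcongr; exact hB z
          _ = B ^ 2 * K (resc x₀ h z.1) * K (resc x₀ h z.1) := by ring
          _ ≤ B ^ 2 * kerSup K * K (resc x₀ h z.1) := by
            gcongr
            · exact hKn _
            · exact hK.le_kerSup _
    _ = B ^ 2 * kerSup K * h ^ d := by
        rw [integral_const_mul, integral_obsLawOne hg hf (by fun_prop)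
          (fun z => hK.abs_le_kerSup _)]
        simp only [integral_const, probReal_univ, one_smul]
        rw [setIntegral_cube_comp_resc hh hKh fun z hz => hz, hK.integral_eq_one, mul_one]

lemma abs_integral_score_le {δ : ℝ} (hδ : ∀ x ∈ nbhd x₀ h, |f x - locPoly x₀ h t x| ≤ δ)
    (hγ : 0 ≤ γ) (p : ↥(multiIdx d b)) (s : ℝ) :
    |∫ z, score γ K x₀ h t p z ∂obsLawOne g s f| ≤ h ^ d * δ := by
  have hinner (x : Fin d → ℝ) :
      |∫ u, score γ K x₀ h t p (x, f x + s * u) ∂noiseLaw g| ≤ K (resc x₀ h x) * δ := by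
    simp only [score, add_sub_right_comm]
    rw [integral_mul_const, abs_mul]
    by_cases hx : K (resc x₀ h x) = 0
    · rw [hx, mul_zero, abs_zero, mul_zero, zero_mul]
    have hbias := (hg.abs_integral_clip_add_le hγ (f x - locPoly x₀ h t x) s).trans
      (hδ x (mem_nbhd_of_ne_zero hK hh hKh hx))
    rw [mul_comm (K _)]
    exact mul_le_mul hbias (hK.abs_monom_mul_le p.1 _) (abs_nonneg _)
      ((abs_nonneg _).trans hbias)
  have hint : Integrable (fun x => K (resc x₀ h x) * δ) (volume.restrict (cube d)) :=
    ((integrable_comp_resc x₀ hh.ne' hK.integrable).mul_const δ).integrableOn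
  rw [integral_obsLawOne hg hf (measurable_score hK p) fun z => (abs_score_le hK hγ p z).trans
    (mul_le_mul_of_nonneg_left (hK.le_kerSup _) hγ)]
  refine (norm_integral_le_of_norm_le
    (f := fun x => ∫ u, score γ K x₀ h t p (x, f x + s * u) ∂noiseLaw g) hint
    (Eventually.of_forall hinner)).trans_eq ?_
  rw [integral_mul_const, setIntegral_cube_comp_resc hh hKh fun z hz => hz,
    hK.integral_eq_one, mul_one]

lemma le_sum_mul_integral_hess {s c : ℝ} (hs : 0 < s) (hγ : 0 < γ) (hc₀ : 0 ≤ c)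
    (hc : c ≤ 2 * ∫ u in (0 : ℝ)..(γ / s), g u)
    (hδ : ∀ x ∈ nbhd x₀ h, |f x - locPoly x₀ h t x| ≤ γ / 16) (w : Coef d b) :
    7 / 8 * c * (minEig d b K * ∑ p, w p ^ 2) * h ^ d ≤
      ∑ p, ∑ q, w p * w q * ∫ z, hess γ K x₀ h t p q z ∂obsLawOne g s f := by
  have := hg.isProbabilityMeasure
  have hKm := hK.measurable
  set φ : (Fin d → ℝ) → ℝ := fun z => polyVal w z ^ 2 * K z
  set Φ := (quadZone γ x₀ h t).indicator fun z => φ (resc x₀ h z.1)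
  have hΦ : Measurable Φ :=
    Measurable.indicator (by fun_prop) (measurableSet_quadZone γ x₀ h t)
  have hΦB (z) : |Φ z| ≤ (∑ p, |w p|) ^ 2 * kerSup K :=
    (norm_indicator_le_norm_self (fun z : (Fin d → ℝ) × ℝ => φ (resc x₀ h z.1)) z).trans
      (hK.abs_polyVal_sq_mul_le w _)
  have hinner (x : Fin d → ℝ) :
      7 / 8 * c * φ (resc x₀ h x) ≤ ∫ u, Φ (x, f x + s * u) ∂noiseLaw g := by
    have hzone (u : ℝ) : Φ (x, f x + s * u) =
        {u | |f x - locPoly x₀ h t x + s * u| ≤ γ - γ / 16}.indicator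
          (fun _ => φ (resc x₀ h x)) u := by
      simp only [Φ, quadZone, indicator, mem_ofPred_eq, add_sub_right_comm]
    simp_rw [hzone]
    rw [integral_indicator_const _ (measurableSet_le (by fun_prop) measurable_const), smul_eq_mul]
    by_cases hx : K (resc x₀ h x) = 0
    · simp only [φ, hx, mul_zero, le_refl]
    · exact mul_le_mul_of_nonneg_right (hg.le_measureReal_abs_add_le hs hγ hc
        (hδ x (mem_nbhd_of_ne_zero hK hh hKh hx))) (mul_nonneg (sq_nonneg _) (hK.nonneg _))
  rw [sum_mul_integral_hess hK hg hf, integral_obsLawOne hg hf hΦ hΦB]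
  calc 7 / 8 * c * (minEig d b K * ∑ p, w p ^ 2) * h ^ d
      ≤ 7 / 8 * c * (∫ z, φ z) * h ^ d := by gcongr; exact hK.minEig_mul_le w
    _ = ∫ x in cube d, 7 / 8 * c * φ (resc x₀ h x) := by
        rw [integral_const_mul, setIntegral_cube_comp_resc hh hKh fun z hz => by
          simp only [φ, hz, mul_zero]]
        ring
    _ ≤ ∫ x in cube d, ∫ u, Φ (x, f x + s * u) ∂noiseLaw g :=
        integral_mono
          ((integrable_comp_resc x₀ hh.ne'
            (hK.integrable_polyVal_sq_mul w)).const_mul _).integrableOn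
          (integrable_comp_observation hg hf hΦ hΦB s).integral_prod_left hinner

end Moments

/-! ### Localisation of minimizers of convex functions -/

section Convex

variable {ι : Type*} [Fintype ι]

lemma sum_abs_le_card_mul {w : ι → ℝ} {δ : ℝ} (hδ : 0 ≤ δ) (hw : ∑ p, w p ^ 2 = δ ^ 2) :
    ∑ p, |w p| ≤ Fintype.card ι * δ := by
  have hle (p : ι) : |w p| ≤ δ := by
    refine abs_le_of_sq_le_sq ?_ hδ
    rw [← hw]
    exact Finset.single_le_sum (fun q _ => sq_nonneg (w q)) (Finset.mem_univ p)
  simpa only [Finset.card_univ, nsmul_eq_mul] using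
    Finset.sum_le_card_nsmul Finset.univ (fun p => |w p|) δ fun p _ => hle p

lemma sub_mul_sum_sq_le_sum_sum_mul {A E : ι → ι → ℝ} {ε : ℝ} (hε : 0 ≤ ε)
    (hAE : ∀ p q, |A p q - E p q| ≤ ε) (w : ι → ℝ) :
    ∑ p, ∑ q, w p * w q * E p q - ε * (Fintype.card ι * ∑ p, w p ^ 2) ≤
      ∑ p, ∑ q, w p * w q * A p q := by
  have hcs : (∑ p, |w p|) ^ 2 ≤ Fintype.card ι * ∑ p, w p ^ 2 := by
    simpa only [sq_abs, Finset.card_univ] using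
      sq_sum_le_card_mul_sum_sq (s := Finset.univ) (f := fun p => |w p|)
  have hterm (p q : ι) : w p * w q * (E p q - A p q) ≤ ε * (|w p| * |w q|) := by
    refine (le_abs_self _).trans ?_
    rw [abs_mul, abs_mul, mul_comm, abs_sub_comm]
    exact mul_le_mul_of_nonneg_right (hAE p q) (by positivity)
  have hdiff : ∑ p, ∑ q, w p * w q * E p q - ∑ p, ∑ q, w p * w q * A p q ≤
      ε * (∑ p, |w p|) ^ 2 := by
    simp_rw [sq, Finset.sum_mul_sum, Finset.mul_sum, ← Finset.sum_sub_distrib, ← mul_sub]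
    exact Finset.sum_le_sum fun p _ => Finset.sum_le_sum fun q _ => hterm p q
  linarith [mul_le_mul_of_nonneg_left hcs hε]

lemma sum_sq_sub_lt_of_convexOn {F : (ι → ℝ) → ℝ} (hF : ConvexOn ℝ univ F) {t θ : ι → ℝ}
    (hθ : F θ ≤ F t) {δ : ℝ} (hδ : 0 < δ)
    (hsphere : ∀ w : ι → ℝ, ∑ p, w p ^ 2 = δ ^ 2 → F t < F (t + w)) :
    ∑ p, (θ p - t p) ^ 2 < δ ^ 2 := by
  by_contra! hfar
  set R := √(∑ p, (θ p - t p) ^ 2)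
  have hδR : δ ≤ R := Real.le_sqrt_of_sq_le hfar
  have hR : 0 < R := hδ.trans_le hδR
  have hsq : R ^ 2 = ∑ p, (θ p - t p) ^ 2 := Real.sq_sqrt (by positivity)
  have hnorm : ∑ p, ((δ / R) • (θ - t)) p ^ 2 = δ ^ 2 := by
    simp only [Pi.smul_apply, Pi.sub_apply, smul_eq_mul, mul_pow]
    rw [← Finset.mul_sum, ← hsq]
    field_simp
  have hseg : t + (δ / R) • (θ - t) ∈ segment ℝ t θ := by
    rw [segment_eq_image']
    exact mem_image_of_mem _ ⟨by positivity, (div_le_one hR).2 hδR⟩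
  exact (hsphere _ hnorm).not_ge ((hF.le_on_segment (mem_univ t) (mem_univ θ) hseg).trans
    (max_le le_rfl hθ))

lemma sum_sum_mul_sum_comm {κ : Type*} [Fintype κ] (w : ι → ℝ) (A : κ → ι → ι → ℝ) :
    ∑ p, ∑ q, w p * w q * ∑ i, A i p q = ∑ i, ∑ p, ∑ q, w p * w q * A i p q := by
  simp_rw [Finset.mul_sum]
  rw [Finset.sum_comm]
  conv_rhs => rw [Finset.sum_comm]; enter [2, p]; rw [Finset.sum_comm]
  exact Finset.sum_comm

end Convex

/-! ### Localisation of the M-estimator -/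

variable {d b n : ℕ} {K : (Fin d → ℝ) → ℝ} {x₀ : Fin d → ℝ} {h γ : ℝ}

lemma locPoly_add (t w : Coef d b) (x : Fin d → ℝ) :
    locPoly x₀ h (t + w) x = locPoly x₀ h t x + locPoly x₀ h w x := by
  simp only [locPoly, Pi.add_apply, add_mul, Finset.sum_add_distrib]
  exact congrFun (indicator_add _ _ _) x

lemma locPoly_smul (a : ℝ) (t : Coef d b) (x : Fin d → ℝ) :
    locPoly x₀ h (a • t) x = a * locPoly x₀ h t x := by
  rw [locPoly, locPoly, ← smul_eq_mul, ← indicator_const_smul_apply]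
  simp only [Pi.smul_apply, smul_eq_mul, Finset.mul_sum, mul_assoc]

/-- The local criterion without its normalisation by `n h^d`. -/
noncomputable def localLoss (γ : ℝ) (K : (Fin d → ℝ) → ℝ) (x₀ : Fin d → ℝ) (h : ℝ)
    (Z : Sample d n) (t : Coef d b) : ℝ :=
  ∑ i, huber γ ((Z i).2 - locPoly x₀ h t (Z i).1) * K (resc x₀ h (Z i).1)

lemma localLoss_le_of_criterion_le (hn : 0 < n) (hh : 0 < h) {Z : Sample d n} {t θ : Coef d b}
    (hθ : criterion (huber γ) K x₀ h Z θ ≤ criterion (huber γ) K x₀ h Z t) :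
    localLoss γ K x₀ h Z θ ≤ localLoss γ K x₀ h Z t :=
  le_of_mul_le_mul_left hθ (by positivity : 0 < 1 / ((n : ℝ) * h ^ d))

lemma convexOn_localLoss (hK : IsKernel K) (hγ : 0 ≤ γ) (Z : Sample d n) :
    ConvexOn ℝ univ (localLoss (b := b) γ K x₀ h Z) := by
  refine ⟨convex_univ, fun t _ v _ a c ha hc hac => ?_⟩
  simp only [localLoss, smul_eq_mul, Finset.mul_sum, ← Finset.sum_add_distrib]
  refine Finset.sum_le_sum fun i _ => ?_
  have hconv := (convexOn_huber hγ).2 (mem_univ ((Z i).2 - locPoly x₀ h t (Z i).1))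
    (mem_univ ((Z i).2 - locPoly x₀ h v (Z i).1)) ha hc hac
  have hres : (Z i).2 - locPoly x₀ h (a • t + c • v) (Z i).1 =
      a * ((Z i).2 - locPoly x₀ h t (Z i).1) + c * ((Z i).2 - locPoly x₀ h v (Z i).1) := by
    rw [locPoly_add, locPoly_smul, locPoly_smul]
    linear_combination (-(Z i).2) * hac
  rw [hres, ← mul_assoc, ← mul_assoc, ← add_mul]
  exact mul_le_mul_of_nonneg_right hconv (hK.nonneg _)

lemma huber_sub_score_add_hess_le (hK : IsKernel K) (hh : 0 < h)
    (hKh : ∀ z, K z ≠ 0 → x₀ + h • z ∈ cube d) (hγ : 0 ≤ γ) (t : Coef d b) {w : Coef d b}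
    (hw : ∑ p, |w p| ≤ γ / 16) (z : (Fin d → ℝ) × ℝ) :
    huber γ (z.2 - locPoly x₀ h t z.1) * K (resc x₀ h z.1) -
        ∑ p, w p * score γ K x₀ h t p z +
        1 / 2 * ∑ p, ∑ q, w p * w q * hess γ K x₀ h t p q z ≤
      huber γ (z.2 - locPoly x₀ h (t + w) z.1) * K (resc x₀ h z.1) := by
  rw [sum_mul_score, sum_mul_hess]
  by_cases hz : K (resc x₀ h z.1) = 0
  · simp only [hz, mul_zero, indicator, ite_self, sub_zero, add_zero, le_refl]
  have hquad := huber_sub_clip_mul_add_le (a := z.2 - locPoly x₀ h t z.1) hγ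
    ((abs_polyVal_le w (hK.support _ hz)).trans hw)
  rw [locPoly_add, locPoly_of_mem_nbhd (t := w) (mem_nbhd_of_ne_zero hK hh hKh hz),
    ← sub_sub]
  refine le_trans (le_of_eq ?_) (mul_le_mul_of_nonneg_right hquad (hK.nonneg _))
  by_cases hq : |z.2 - locPoly x₀ h t z.1| ≤ γ - γ / 16
  · rw [indicator_of_mem (show z ∈ quadZone γ x₀ h t from hq), if_pos hq]
    ring
  · rw [indicator_of_notMem (show z ∉ quadZone γ x₀ h t from hq), if_neg hq]
    ring

lemma localLoss_sub_score_add_hess_le (hK : IsKernel K) (hh : 0 < h)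
    (hKh : ∀ z, K z ≠ 0 → x₀ + h • z ∈ cube d) (hγ : 0 ≤ γ) (Z : Sample d n) (t : Coef d b)
    {w : Coef d b} (hw : ∑ p, |w p| ≤ γ / 16) :
    localLoss γ K x₀ h Z t - ∑ p, w p * ∑ i, score γ K x₀ h t p (Z i) +
        1 / 2 * ∑ p, ∑ q, w p * w q * ∑ i, hess γ K x₀ h t p q (Z i) ≤
      localLoss γ K x₀ h Z (t + w) := by
  have hscore : ∑ p, w p * ∑ i, score γ K x₀ h t p (Z i) =
      ∑ i, ∑ p, w p * score γ K x₀ h t p (Z i) := by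
    simp_rw [Finset.mul_sum]
    exact Finset.sum_comm
  rw [hscore, sum_sum_mul_sum_comm w fun i p q => hess γ K x₀ h t p q (Z i), localLoss,
    ← Finset.sum_sub_distrib, Finset.mul_sum, ← Finset.sum_add_distrib]
  exact Finset.sum_le_sum fun i _ => huber_sub_score_add_hess_le hK hh hKh hγ t hw (Z i)

lemma abs_sub_lt_of_score_hess (hK : IsKernel K) (hh : 0 < h)
    (hKh : ∀ z, K z ≠ 0 → x₀ + h • z ∈ cube d) (hγ : 0 ≤ γ) {Z : Sample d n} {t θ : Coef d b}
    (hθ : localLoss γ K x₀ h Z θ ≤ localLoss γ K x₀ h Z t) {y κ δ : ℝ} (hδ : 0 < δ)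
    (hδγ : numIdx d b * δ ≤ γ / 16) (hscore : ∀ p, |∑ i, score γ K x₀ h t p (Z i)| ≤ y)
    (hhess : ∀ w : Coef d b, κ * ∑ p, w p ^ 2 ≤
      ∑ p, ∑ q, w p * w q * ∑ i, hess γ K x₀ h t p q (Z i))
    (hbal : numIdx d b * y < κ / 2 * δ) (p : ↥(multiIdx d b)) :
    |θ p - t p| < δ := by
  refine abs_lt_of_sq_lt_sq ((Finset.single_le_sum (fun q _ => sq_nonneg (θ q - t q))
    (Finset.mem_univ p)).trans_lt ?_) hδ.le
  refine sum_sq_sub_lt_of_convexOn (convexOn_localLoss hK hγ Z) hθ hδ fun w hw => ?_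
  have hw₁ : ∑ p, |w p| ≤ numIdx d b * δ := by
    simpa only [numIdx, Fintype.card_coe] using sum_abs_le_card_mul hδ.le hw
  have hlin : ∑ p, w p * ∑ i, score γ K x₀ h t p (Z i) ≤ numIdx d b * δ * y :=
    calc ∑ p, w p * ∑ i, score γ K x₀ h t p (Z i)
        ≤ ∑ p, |w p| * y := Finset.sum_le_sum fun q _ => by
          refine (le_abs_self _).trans ?_
          rw [abs_mul]
          exact mul_le_mul_of_nonneg_left (hscore q) (abs_nonneg _)
      _ = (∑ p, |w p|) * y := (Finset.sum_mul _ _ _).symm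
      _ ≤ numIdx d b * δ * y :=
          mul_le_mul_of_nonneg_right hw₁ ((abs_nonneg _).trans (hscore p))
  have hquad := localLoss_sub_score_add_hess_le hK hh hKh hγ Z t (hw₁.trans hδγ)
  have hpos := hhess w
  rw [hw] at hpos
  nlinarith [mul_lt_mul_of_pos_right hbal hδ]

/-! ### Exponential bound for the local estimator -/

section Tail

variable {g : ℝ → ℝ} {σ : ℕ → ℝ} {f : (Fin d → ℝ) → ℝ}

/-- The sum of `Φ` over the sample, centred at its mean. -/
noncomputable def centredSum (g : ℝ → ℝ) (σ : ℕ → ℝ) (f : (Fin d → ℝ) → ℝ)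
    (Φ : (Fin d → ℝ) × ℝ → ℝ) (Z : Sample d n) : ℝ :=
  ∑ i, Φ (Z i) - ∑ i : Fin n, ∫ z, Φ z ∂obsLawOne g (σ i) f

lemma isProbabilityMeasure_obsLaw (hg : IsSymmDensity g)
    (hf : AEMeasurable f (volume.restrict (cube d))) :
    IsProbabilityMeasure (obsLaw g σ f n) := by
  have (i : Fin n) : IsProbabilityMeasure (obsLawOne g (σ i) f) :=
    isProbabilityMeasure_obsLawOne hg hf _
  unfold obsLaw; infer_instance

variable (hK : IsKernel K) (hh : 0 < h) (hKh : ∀ z, K z ≠ 0 → x₀ + h • z ∈ cube d)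
  (hg : IsSymmDensity g) (hf : AEMeasurable f (volume.restrict (cube d)))
include hK hh hKh hg hf

lemma measureReal_le_abs_centredSum_le (hn : 0 < n) {Φ : (Fin d → ℝ) × ℝ → ℝ}
    (hΦ : Measurable Φ) {B x : ℝ} (hB : 0 < B) (hΦB : ∀ z, |Φ z| ≤ B * K (resc x₀ h z.1))
    (hx : 0 ≤ x) (hxB : x ≤ B) :
    (obsLaw g σ f n).real {Z | n * h ^ d * x ≤ |centredSum g σ f Φ Z|} ≤
      2 * Real.exp (-(n * h ^ d * x ^ 2 / (4 * (B ^ 2 * kerSup K)))) := by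
  have (i : Fin n) : IsProbabilityMeasure (obsLawOne g (σ i) f) :=
    isProbabilityMeasure_obsLawOne hg hf _
  have hK₁ : 0 < kerSup K := zero_lt_one.trans_le hK.one_le_kerSup
  have hΦB' (z) : |Φ z| ≤ B * kerSup K :=
    (hΦB z).trans (mul_le_mul_of_nonneg_left (hK.le_kerSup _) hB.le)
  have hvar : ∑ i : Fin n, ∫ z, Φ z ^ 2 ∂obsLawOne g (σ i) f ≤ n * (B ^ 2 * kerSup K * h ^ d) := by
    simpa only [Finset.card_univ, Fintype.card_fin, nsmul_eq_mul] using
      Finset.sum_le_card_nsmul Finset.univ _ _ fun (i : Fin n) _ =>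
        integral_sq_obsLawOne_le hK hg hf hh hKh hΦB (σ i)
  refine (measureReal_pi_abs_sum_sub_integral_ge_le (W := fun _ : Fin n => Φ)
    (fun i => hΦ.aemeasurable) (fun i => Eventually.of_forall hΦB') (by positivity) hvar
    (by positivity) ?_).trans_eq ?_
  · calc n * h ^ d * x * (B * kerSup K) ≤ n * h ^ d * B * (B * kerSup K) := by gcongr
      _ = n * (B ^ 2 * kerSup K * h ^ d) := by ring
  · congr 3
    field_simp

lemma abs_sum_score_le {t : Coef d b} {B y : ℝ}
    (hB : ∀ x ∈ nbhd x₀ h, |f x - locPoly x₀ h t x| ≤ B) (hγ : 0 ≤ γ) {p : ↥(multiIdx d b)}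
    {Z : Sample d n} (hy : |centredSum g σ f (score γ K x₀ h t p) Z| ≤ n * h ^ d * y) :
    |∑ i, score γ K x₀ h t p (Z i)| ≤ n * h ^ d * (y + B) := by
  have hmean : |∑ i : Fin n, ∫ z, score γ K x₀ h t p z ∂obsLawOne g (σ i) f| ≤
      n * (h ^ d * B) := by
    simpa only [Finset.card_univ, Fintype.card_fin, nsmul_eq_mul] using
      (Finset.abs_sum_le_sum_abs _ _).trans (Finset.sum_le_card_nsmul Finset.univ _ _
        fun (i : Fin n) _ => abs_integral_score_le hK hg hf hh hKh hB hγ p (σ i))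
  have htri := abs_sub_abs_le_abs_sub (∑ i, score γ K x₀ h t p (Z i))
    (∑ i : Fin n, ∫ z, score γ K x₀ h t p z ∂obsLawOne g (σ i) f)
  rw [centredSum] at hy
  linarith

lemma mul_sum_sq_le_sum_sum_mul_hess (hσ : ∀ i, 0 < σ i) (hγ : 0 < γ) {c η : ℝ} (hc₀ : 0 ≤ c)
    (hc : ∀ i, c ≤ 2 * ∫ u in (0 : ℝ)..(γ / σ i), g u) {t : Coef d b}
    (hδ : ∀ x ∈ nbhd x₀ h, |f x - locPoly x₀ h t x| ≤ γ / 16) {Z : Sample d n} (hη₀ : 0 ≤ η)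
    (hη : ∀ p q, |centredSum g σ f (hess γ K x₀ h t p q) Z| ≤ n * h ^ d * η)
    (hηc : numIdx d b * η ≤ c * minEig d b K / 8) (w : Coef d b) :
    n * h ^ d * (3 / 4 * (c * minEig d b K)) * ∑ p, w p ^ 2 ≤
      ∑ p, ∑ q, w p * w q * ∑ i, hess γ K x₀ h t p q (Z i) := by
  have hmean : n * (7 / 8 * c * (minEig d b K * ∑ p, w p ^ 2) * h ^ d) ≤
      ∑ p, ∑ q, w p * w q * ∑ i : Fin n, ∫ z, hess γ K x₀ h t p q z ∂obsLawOne g (σ i) f := by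
    rw [sum_sum_mul_sum_comm w fun (i : Fin n) p q =>
      ∫ z, hess γ K x₀ h t p q z ∂obsLawOne g (σ i) f]
    simpa only [Finset.card_univ, Fintype.card_fin, nsmul_eq_mul] using
      Finset.card_nsmul_le_sum Finset.univ _ _ fun (i : Fin n) _ =>
        le_sum_mul_integral_hess hK hg hf hh hKh (hσ i) hγ hc₀ (hc i) hδ w
  have hpert := sub_mul_sum_sq_le_sum_sum_mul (by positivity) hη w
  rw [Fintype.card_coe, ← numIdx] at hpert
  have hsmall : n * h ^ d * (numIdx d b * η) * ∑ p, w p ^ 2 ≤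
      n * h ^ d * (c * minEig d b K / 8) * ∑ p, w p ^ 2 := by gcongr
  linarith

theorem measureReal_local_error_le (hσ : ∀ i, 0 < σ i) (hn : 0 < n) (hγ : 0 < γ) {c : ℝ}
    (hc₀ : 0 ≤ c) (hc : ∀ i, c ≤ 2 * ∫ u in (0 : ℝ)..(γ / σ i), g u) {t : Coef d b} {B : ℝ}
    (hB : ∀ x ∈ nbhd x₀ h, |f x - locPoly x₀ h t x| ≤ B) (hBγ : B ≤ γ / 16)
    {θ : Sample d n → Coef d b}
    (hθ : ∀ Z, criterion (huber γ) K x₀ h Z (θ Z) ≤ criterion (huber γ) K x₀ h Z t)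
    {x δ η : ℝ} (hx : 0 ≤ x) (hxγ : x ≤ γ) (hδ : 0 < δ) (hδγ : numIdx d b * δ ≤ γ / 16)
    (hη : 0 ≤ η) (hη₁ : η ≤ 1) (hηc : numIdx d b * η ≤ c * minEig d b K / 8)
    (hbal : numIdx d b * (x + B) < 3 / 8 * (c * minEig d b K) * δ) (p : ↥(multiIdx d b)) :
    (obsLaw g σ f n).real {Z | δ ≤ |θ Z p - t p|} ≤
      numIdx d b * (2 * Real.exp (-(n * h ^ d * x ^ 2 / (4 * (γ ^ 2 * kerSup K))))) +
      numIdx d b ^ 2 * (2 * Real.exp (-(n * h ^ d * η ^ 2 / (4 * kerSup K)))) := by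
  have := isProbabilityMeasure_obsLaw (σ := σ) (n := n) hg hf
  set S : ↥(multiIdx d b) → Set (Sample d n) := fun p =>
    {Z | n * h ^ d * x ≤ |centredSum g σ f (score γ K x₀ h t p) Z|}
  set H : ↥(multiIdx d b) × ↥(multiIdx d b) → Set (Sample d n) := fun pq =>
    {Z | n * h ^ d * η ≤ |centredSum g σ f (hess γ K x₀ h t pq.1 pq.2) Z|}
  have hsub : {Z | δ ≤ |θ Z p - t p|} ⊆ (⋃ p, S p) ∪ ⋃ pq, H pq := by
    intro Z hZ
    by_contra hgood
    simp only [mem_union, mem_iUnion, not_or, not_exists, S, H, mem_ofPred_eq, not_le,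
      Prod.forall] at hgood
    refine (abs_sub_lt_of_score_hess hK hh hKh hγ.le
      (localLoss_le_of_criterion_le hn hh (hθ Z)) hδ hδγ
      (fun q => abs_sum_score_le hK hh hKh hg hf hB hγ.le (hgood.1 q).le)
      (mul_sum_sq_le_sum_sum_mul_hess hK hh hKh hg hf hσ hγ hc₀ hc
        (fun x hx => (hB x hx).trans hBγ) hη (fun q q' => (hgood.2 q q').le) hηc) ?_ p).not_ge hZ
    have hpos : (0 : ℝ) < n * h ^ d := by positivity
    linarith [mul_lt_mul_of_pos_left hbal hpos]
  have hS (p) := measureReal_le_abs_centredSum_le (σ := σ) hK hh hKh hg hf hn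
    (measurable_score hK p) hγ (abs_score_le (t := t) hK hγ.le p) hx hxγ
  have hH (p q) := measureReal_le_abs_centredSum_le (σ := σ) hK hh hKh hg hf hn
    (measurable_hess (γ := γ) (t := t) hK p q) one_pos
    (by simpa only [one_mul] using abs_hess_le hK p q) hη hη₁
  calc (obsLaw g σ f n).real {Z | δ ≤ |θ Z p - t p|}
      ≤ ∑ p, (obsLaw g σ f n).real (S p) + ∑ pq, (obsLaw g σ f n).real (H pq) :=
        (measureReal_mono hsub).trans ((measureReal_union_le _ _).trans
          (add_le_add (measureReal_iUnion_fintype_le _) (measureReal_iUnion_fintype_le _)))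
    _ ≤ _ := by
        refine add_le_add ((Finset.sum_le_card_nsmul _ _ _ fun p _ => hS p).trans_eq ?_)
          ((Finset.sum_le_card_nsmul _ _ _ fun pq _ => hH pq.1 pq.2).trans_eq ?_)
        · rw [Finset.card_univ, Fintype.card_coe, nsmul_eq_mul, numIdx]
        · rw [Finset.card_univ, Fintype.card_prod, Fintype.card_coe, nsmul_eq_mul, numIdx,
            one_pow, one_mul, Nat.cast_mul, ← sq]

end Tail

/-! ### Bandwidths and noise levels -/

section Bandwidth

variable {d b n : ℕ}

/-- The logarithmic weight `1 + l ln 2` in the noise level `S_n(l)`. -/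
noncomputable def weight (l : ℕ) : ℝ := 1 + l * Real.log 2

lemma one_le_weight (l : ℕ) : 1 ≤ weight l :=
  le_add_of_nonneg_right (mul_nonneg l.cast_nonneg (Real.log_nonneg one_le_two))

lemma weight_zero : weight 0 = 1 := by
  rw [weight, Nat.cast_zero, zero_mul, add_zero]

lemma weight_succ (l : ℕ) : weight (l + 1) = weight l + Real.log 2 := by
  rw [weight, weight, Nat.cast_succ]
  ring

lemma weight_mono : Monotone weight :=
  monotone_nat_of_le_succ fun l => by
    rw [weight_succ]
    exact le_add_of_nonneg_right (Real.log_nonneg one_le_two)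

lemma two_pow_eq_exp_weight (l : ℕ) : (2 : ℝ) ^ l = Real.exp (weight l - 1) := by
  rw [weight, add_sub_cancel_left, Real.exp_nat_mul, Real.exp_log two_pos]

lemma hMax_pos (hn : 0 < n) : 0 < hMax d b n :=
  Real.rpow_pos_of_pos (Nat.cast_pos.2 hn) _

lemma hMax_le_one (hn : 0 < n) : hMax d b n ≤ 1 :=
  Real.rpow_le_one_of_one_le_of_nonpos (Nat.one_le_cast.2 hn) (by rw [neg_nonpos]; positivity)

lemma log_hMax (hn : 0 < n) : Real.log (hMax d b n) = -(Real.log n / (2 * b + d)) := by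
  rw [hMax, Real.log_rpow (Nat.cast_pos.2 hn)]
  ring

lemma bandwidth_zero : bandwidth d b n 0 = hMax d b n := by
  rw [bandwidth, pow_zero, div_one]

lemma bandwidth_pos (hn : 0 < n) (l : ℕ) : 0 < bandwidth d b n l :=
  div_pos (hMax_pos hn) (by positivity)

lemma bandwidth_anti (hn : 0 < n) : Antitone (bandwidth d b n) := fun _ _ hkl =>
  div_le_div_of_nonneg_left (hMax_pos hn).le (by positivity) (pow_le_pow_right₀ one_le_two hkl)

lemma bandwidth_le_hMax (hn : 0 < n) (l : ℕ) : bandwidth d b n l ≤ hMax d b n :=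
  (bandwidth_anti hn l.zero_le).trans_eq bandwidth_zero

lemma bandwidth_mem_Ioc (hn : 0 < n) (l : ℕ) : bandwidth d b n l ∈ Ioc (0 : ℝ) 1 :=
  ⟨bandwidth_pos hn l, (bandwidth_le_hMax hn l).trans (hMax_le_one hn)⟩

lemma log_bandwidth (hn : 0 < n) (l : ℕ) :
    Real.log (bandwidth d b n l) = -(Real.log n / (2 * b + d)) - (weight l - 1) := by
  rw [bandwidth, Real.log_div (hMax_pos hn).ne' (by positivity), log_hMax hn, Real.log_pow, weight]
  ring

lemma noiseLevel_nonneg (l : ℕ) : 0 ≤ noiseLevel d b n l := Real.sqrt_nonneg _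

lemma mul_bandwidth_pow_pos (hn : 0 < n) (l : ℕ) : 0 < n * bandwidth d b n l ^ d :=
  mul_pos (Nat.cast_pos.2 hn) (pow_pos (bandwidth_pos hn l) d)

lemma noiseLevel_pos (hn : 0 < n) (l : ℕ) : 0 < noiseLevel d b n l :=
  Real.sqrt_pos.2 (div_pos (zero_lt_one.trans_le (one_le_weight l)) (mul_bandwidth_pow_pos hn l))

lemma mul_noiseLevel_sq (hn : 0 < n) (l : ℕ) :
    n * bandwidth d b n l ^ d * noiseLevel d b n l ^ 2 = weight l := by
  have hpos := mul_bandwidth_pow_pos (d := d) (b := b) hn l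
  rw [noiseLevel, ← weight,
    Real.sq_sqrt (div_nonneg (zero_le_one.trans (one_le_weight l)) hpos.le),
    mul_div_cancel₀ _ hpos.ne']

lemma noiseLevel_sq (hn : 0 < n) (l : ℕ) :
    noiseLevel d b n l ^ 2 = weight l / (n * bandwidth d b n l ^ d) := by
  rw [eq_div_iff (mul_bandwidth_pow_pos hn l).ne', mul_comm, mul_noiseLevel_sq hn]

lemma noiseLevel_mono (hn : 0 < n) : Monotone (noiseLevel d b n) := fun k l hkl => by
  refine Real.sqrt_le_sqrt (div_le_div₀ (zero_le_one.trans (one_le_weight l)) (weight_mono hkl)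
    (mul_bandwidth_pow_pos hn l) ?_)
  have := (bandwidth_pos (d := d) (b := b) hn l).le
  have := bandwidth_anti (d := d) (b := b) hn hkl
  gcongr

lemma noiseLevel_sq_eq_mul_noiseLevel_zero_sq (hn : 0 < n) (l : ℕ) :
    noiseLevel d b n l ^ 2 =
      weight l * Real.exp (d * (weight l - 1)) * noiseLevel d b n 0 ^ 2 := by
  have := hMax_pos (d := d) (b := b) hn
  rw [noiseLevel_sq hn, noiseLevel_sq hn, Real.exp_nat_mul, ← two_pow_eq_exp_weight, weight_zero,
    bandwidth_zero, bandwidth, div_pow]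
  field_simp

lemma two_mul_log_noiseLevel (hn : 0 < n) (l : ℕ) :
    2 * Real.log (noiseLevel d b n l) =
      Real.log (weight l) - Real.log n - d * Real.log (bandwidth d b n l) := by
  have hw : weight l ≠ 0 := (zero_lt_one.trans_le (one_le_weight l)).ne'
  have hh := bandwidth_pos (d := d) (b := b) hn l
  rw [← Nat.cast_two, ← Real.log_pow, noiseLevel_sq hn,
    Real.log_div hw (mul_bandwidth_pow_pos hn l).ne', Real.log_mul (by positivity) (by positivity),
    Real.log_pow, sub_sub]

lemma log_noiseLevel_zero (hd : 0 < d) (hn : 0 < n) :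
    Real.log (noiseLevel d b n 0) = -(b / (2 * b + d) * Real.log n) := by
  have hlog := two_mul_log_noiseLevel (d := d) (b := b) hn 0
  rw [weight_zero, Real.log_one, log_bandwidth hn, weight_zero] at hlog
  field_simp at hlog ⊢
  linarith

lemma noiseLevel_succ_le (hn : 0 < n) (j : ℕ) :
    noiseLevel d b n (j + 1) ≤ 2 ^ (d + 1) * noiseLevel d b n j := by
  have hw : weight (j + 1) ≤ 2 * weight j := by
    rw [weight_succ]
    linarith [one_le_weight j, Real.log_two_lt_d9]
  have hh := bandwidth_pos (d := d) (b := b) hn j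
  have hhalf : bandwidth d b n (j + 1) = bandwidth d b n j / 2 := by
    rw [bandwidth, bandwidth, pow_succ, div_mul_eq_div_div]
  refine le_of_sq_le_sq ?_ (mul_nonneg (by positivity) (noiseLevel_nonneg j))
  rw [mul_pow, noiseLevel_sq hn, noiseLevel_sq hn, hhalf, div_pow]
  calc weight (j + 1) / (n * (bandwidth d b n j ^ d / 2 ^ d))
      ≤ 2 * weight j / (n * (bandwidth d b n j ^ d / 2 ^ d)) := by gcongr
    _ = 2 ^ (d + 1) * (weight j / (n * bandwidth d b n j ^ d)) := by field_simp; ring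
    _ ≤ (2 ^ (d + 1)) ^ 2 * (weight j / (n * bandwidth d b n j ^ d)) := by
        have := one_le_weight j
        gcongr
        exact le_self_pow₀ (one_le_pow₀ one_le_two) two_ne_zero

end Bandwidth

/-! ### The smallest bandwidth -/

section LastIdx

variable {d b n : ℕ}

lemma pos_of_log_pos (hl : 0 < Real.log n) : 0 < n :=
  Nat.pos_of_ne_zero fun hn => by rw [hn, Nat.cast_zero, Real.log_zero] at hl; exact hl.false

lemma hMin_pos (hl : 0 < Real.log n) : 0 < hMin d n :=
  mul_pos (Real.rpow_pos_of_pos hl _) (Real.rpow_pos_of_pos (Nat.cast_pos.2 (pos_of_log_pos hl)) _)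

lemma log_hMin (hl : 0 < Real.log n) :
    Real.log (hMin d n) = 2 / d * Real.log (Real.log n) - Real.log n / d := by
  have hn : (0 : ℝ) < n := Nat.cast_pos.2 (pos_of_log_pos hl)
  rw [hMin, Real.log_mul (by positivity) (by positivity), Real.log_rpow hl, Real.log_rpow hn]
  ring

lemma mul_hMin_pow (hd : 0 < d) (hl : 0 < Real.log n) : n * hMin d n ^ d = Real.log n ^ 2 := by
  have hn : (0 : ℝ) < n := Nat.cast_pos.2 (pos_of_log_pos hl)
  have hd₀ : (d : ℝ) ≠ 0 := by positivity
  rw [hMin, mul_pow, ← Real.rpow_natCast (_ ^ _) d, ← Real.rpow_natCast (_ ^ _) d,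
    ← Real.rpow_mul hl.le, ← Real.rpow_mul hn.le, div_mul_cancel₀ _ hd₀,
    neg_mul, div_mul_cancel₀ _ hd₀, Real.rpow_neg_one, Real.rpow_two]
  field_simp

lemma eventually_le_log (A : ℝ) : ∀ᶠ n : ℕ in atTop, A ≤ Real.log n :=
  (Real.tendsto_log_atTop.comp tendsto_natCast_atTop_atTop).eventually_ge_atTop A

lemma eventually_add_mul_log_log_le (A B : ℝ) {ε : ℝ} (hε : 0 < ε) :
    ∀ᶠ n : ℕ in atTop, A + B * Real.log (Real.log n) ≤ ε * Real.log n := by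
  have hlittle : (fun x : ℝ => A + B * Real.log x) =o[atTop] fun x : ℝ => x :=
    (Asymptotics.isLittleO_const_left.2 (Or.inr tendsto_norm_atTop_atTop)).add
      (Real.isLittleO_log_id_atTop.const_mul_left B)
  filter_upwards [(Real.tendsto_log_atTop.comp tendsto_natCast_atTop_atTop).eventually
    (hlittle.bound hε), eventually_le_log 0] with n hn hl
  rw [Function.comp_apply, Real.norm_eq_abs, Real.norm_eq_abs, abs_of_nonneg hl] at hn
  exact (le_abs_self _).trans hn

lemma eventually_hMax_le (hd : 0 < d) {h₀ : ℝ} (hh₀ : 0 < h₀) :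
    ∀ᶠ n : ℕ in atTop, hMax d b n ≤ h₀ := by
  filter_upwards [eventually_le_log (-Real.log h₀ * (2 * b + d)), eventually_gt_atTop 0]
    with n hlog hn
  rw [← Real.log_le_log_iff (hMax_pos hn) hh₀, log_hMax hn, neg_le]
  exact (le_div_iff₀ (by positivity)).2 hlog

lemma eventually_hMin_le_hMax (hd : 0 < d) (hb : 0 < b) :
    ∀ᶠ n : ℕ in atTop, hMin d n ≤ hMax d b n := by
  filter_upwards [eventually_add_mul_log_log_le 0 (2 / d)
    (by positivity : (0 : ℝ) < 2 * b / (d * (2 * b + d))), eventually_le_log 1] with n hloglog hl₁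
  have hl : 0 < Real.log n := zero_lt_one.trans_le hl₁
  have hn := pos_of_log_pos hl
  have hgap : 2 * (b : ℝ) / (d * (2 * b + d)) * Real.log n =
      Real.log n / d - Real.log n / (2 * b + d) := by
    field_simp
    ring
  rw [← Real.log_le_log_iff (hMin_pos hl) (hMax_pos hn), log_hMin hl, log_hMax hn]
  linarith

lemma bddAbove_setOf_hMin_le_bandwidth (hl : 0 < Real.log n) :
    BddAbove {k : ℕ | hMin d n ≤ bandwidth d b n k} := by
  have hmin := hMin_pos (d := d) hl
  refine ⟨⌈hMax d b n / hMin d n⌉₊, fun k (hk : hMin d n ≤ hMax d b n / 2 ^ k) => ?_⟩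
  have hk_lt : (k : ℝ) < 2 ^ k := by exact_mod_cast Nat.lt_two_pow_self
  refine Nat.cast_le.1 (le_trans ?_ (Nat.le_ceil _))
  rw [le_div_iff₀ hmin]
  rw [le_div_iff₀ (by positivity)] at hk
  nlinarith

lemma eventually_hMin_mem_Ioc_bandwidth_lastIdx (hd : 0 < d) (hb : 0 < b) :
    ∀ᶠ n : ℕ in atTop, hMin d n ∈
      Ioc (bandwidth d b n (lastIdx d b n + 1)) (bandwidth d b n (lastIdx d b n)) := by
  filter_upwards [eventually_hMin_le_hMax hd hb, eventually_le_log 1] with n hle hl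
  have hbdd := bddAbove_setOf_hMin_le_bandwidth (d := d) (b := b) (zero_lt_one.trans_le hl)
  refine ⟨?_, Nat.sSup_mem ⟨0, hle.trans_eq bandwidth_zero.symm⟩ hbdd⟩
  by_contra! hsucc
  exact (Nat.lt_succ_self (lastIdx d b n)).not_ge (le_csSup hbdd hsucc)

lemma log_sq_le_mul_bandwidth_pow (hd : 0 < d) (hl : 0 < Real.log n)
    (hlast : hMin d n ≤ bandwidth d b n (lastIdx d b n)) {l : ℕ} (hl_last : l ≤ lastIdx d b n) :
    Real.log n ^ 2 ≤ n * bandwidth d b n l ^ d := by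
  rw [← mul_hMin_pow hd hl]
  have := (hMin_pos (d := d) hl).le
  have := hlast.trans (bandwidth_anti (pos_of_log_pos hl) hl_last)
  gcongr

lemma weight_le_two_mul_log (hd : 0 < d) (hl : 1 ≤ Real.log n)
    (hlast : hMin d n ≤ bandwidth d b n (lastIdx d b n)) {l : ℕ} (hl_last : l ≤ lastIdx d b n) :
    weight l ≤ 2 * Real.log n := by
  have hl₀ : 0 < Real.log n := zero_lt_one.trans_le hl
  have hn := pos_of_log_pos hl₀
  have hlog := Real.log_le_log (hMin_pos hl₀) (hlast.trans (bandwidth_anti hn hl_last))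
  rw [log_hMin hl₀, log_bandwidth hn] at hlog
  have hloglog : 0 ≤ 2 / (d : ℝ) * Real.log (Real.log n) :=
    mul_nonneg (by positivity) (Real.log_nonneg hl)
  have hmax : 0 ≤ Real.log n / (2 * b + d) := by positivity
  have hdiv : Real.log n / d ≤ Real.log n := div_le_self hl₀.le (Nat.one_le_cast.2 hd)
  linarith

lemma eventually_noiseLevel_le (hd : 0 < d) (hb : 0 < b) {s : ℝ} (hs : 0 < s) :
    ∀ᶠ n : ℕ in atTop, ∀ l ≤ lastIdx d b n, noiseLevel d b n l ≤ s := by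
  filter_upwards [eventually_hMin_mem_Ioc_bandwidth_lastIdx hd hb, eventually_le_log 1,
    eventually_le_log (2 / s ^ 2)] with n hlast hl hls l hl_last
  have hl₀ : 0 < Real.log n := zero_lt_one.trans_le hl
  refine le_of_sq_le_sq ?_ hs.le
  rw [noiseLevel_sq (pos_of_log_pos hl₀)]
  calc weight l / (n * bandwidth d b n l ^ d) ≤ 2 * Real.log n / Real.log n ^ 2 := by
        have := weight_le_two_mul_log hd hl hlast.2 hl_last
        have := log_sq_le_mul_bandwidth_pow hd hl₀ hlast.2 hl_last
        gcongr
    _ = 2 / Real.log n := by field_simp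
    _ ≤ s ^ 2 := (div_le_comm₀ (by positivity) hl₀).1 hls

lemma eventually_weight_le (hd : 0 < d) (hb : 0 < b) {κ : ℝ} (hκ : 0 < κ) :
    ∀ᶠ n : ℕ in atTop, ∀ l ≤ lastIdx d b n, weight l ≤ κ * (n * bandwidth d b n l ^ d) := by
  filter_upwards [eventually_hMin_mem_Ioc_bandwidth_lastIdx hd hb, eventually_le_log 1,
    eventually_le_log (2 / κ)] with n hlast hl hlκ l hl_last
  have hl₀ : 0 < Real.log n := zero_lt_one.trans_le hl
  rw [div_le_iff₀' hκ] at hlκ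
  calc weight l ≤ 2 * Real.log n := weight_le_two_mul_log hd hl hlast.2 hl_last
    _ ≤ κ * Real.log n * Real.log n := by gcongr
    _ = κ * Real.log n ^ 2 := by ring
    _ ≤ κ * (n * bandwidth d b n l ^ d) := by
        gcongr
        exact log_sq_le_mul_bandwidth_pow hd hl₀ hlast.2 hl_last

lemma log_bandwidth_lt_of_bandwidth_succ_lt (hl : 0 < Real.log n) {l : ℕ}
    (hsucc : bandwidth d b n (l + 1) < hMin d n) :
    Real.log (bandwidth d b n l) <
      2 / d * Real.log (Real.log n) - Real.log n / d + Real.log 2 := by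
  have hn := pos_of_log_pos hl
  have hlog := Real.log_lt_log (bandwidth_pos hn _) hsucc
  rw [log_hMin hl, log_bandwidth hn, weight_succ] at hlog
  rw [log_bandwidth hn]
  linarith

lemma eventually_bias_lastIdx_le (hd : 0 < d) (hb : 0 < b) {β L : ℝ} (hβ : 0 < β) (hL : 0 < L) :
    ∀ᶠ n : ℕ in atTop, L * (d * bandwidth d b n (lastIdx d b n) / 2) ^ β ≤
      noiseLevel d b n (lastIdx d b n) / 2 := by
  filter_upwards [eventually_hMin_mem_Ioc_bandwidth_lastIdx hd hb, eventually_le_log 1,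
    eventually_add_mul_log_log_le (Real.log (L * (d / 2) ^ β) + (β + 1 + d / 2) * Real.log 2)
      (β * (2 / d) + 1) (by positivity : 0 < β / d)] with n hlast hl₁ hloglog
  have hl : 0 < Real.log n := zero_lt_one.trans_le hl₁
  have hn := pos_of_log_pos hl
  have hh := bandwidth_pos (d := d) (b := b) hn (lastIdx d b n)
  have hS := noiseLevel_pos (d := d) (b := b) hn (lastIdx d b n)
  have hlogh := (log_bandwidth_lt_of_bandwidth_succ_lt hl hlast.1).le
  have hlogS := two_mul_log_noiseLevel (d := d) (b := b) hn (lastIdx d b n)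
  have hw := Real.log_nonneg (one_le_weight (lastIdx d b n))
  have hβlogh := mul_le_mul_of_nonneg_left hlogh hβ.le
  have hdlogh : d * Real.log (bandwidth d b n (lastIdx d b n)) ≤
      2 * Real.log (Real.log n) - Real.log n + d * Real.log 2 :=
    (mul_le_mul_of_nonneg_left hlogh (by positivity)).trans_eq (by field_simp)
  rw [mul_div_right_comm, Real.mul_rpow (by positivity) hh.le, ← mul_assoc,
    ← Real.log_le_log_iff (by positivity) (by positivity),
    Real.log_mul (by positivity) (by positivity), Real.log_rpow hh,
    Real.log_div hS.ne' two_ne_zero]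
  linear_combination hloglog + hβlogh + hdlogh / 2 + hw / 2 - hlogS / 2

lemma eventually_exp_weight_lastIdx_le (hd : 0 < d) (hb : 0 < b) :
    ∀ᶠ n : ℕ in atTop, Real.exp (-(9 / 16 * d * weight (lastIdx d b n))) ≤
      noiseLevel d b n 0 := by
  filter_upwards [eventually_hMin_mem_Ioc_bandwidth_lastIdx hd hb, eventually_le_log 1,
    eventually_add_mul_log_log_le 0 9 (by positivity : (0 : ℝ) < b / (2 * b + d))]
    with n hlast hl₁ hloglog
  have hl : 0 < Real.log n := zero_lt_one.trans_le hl₁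
  have hn := pos_of_log_pos hl
  rw [← Real.le_log_iff_exp_le (noiseLevel_pos hn 0), log_noiseLevel_zero hd hn, neg_le_neg_iff]
  have hlog := log_bandwidth_lt_of_bandwidth_succ_lt hl hlast.1
  rw [log_bandwidth hn] at hlog
  have hgap : Real.log n / d - Real.log n / (2 * b + d) =
      2 / d * (b / (2 * b + d) * Real.log n) := by
    field_simp
    ring
  have hweight : 2 / d * (b / (2 * b + d) * Real.log n - Real.log (Real.log n)) ≤
      weight (lastIdx d b n) := by
    rw [mul_sub, ← hgap]
    linarith [Real.log_two_lt_d9]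
  rw [div_mul_eq_mul_div, div_le_iff₀' (by positivity)] at hweight
  linarith

end LastIdx

/-! ### The adaptive rate -/

section Rate

variable {d b n : ℕ} {β : ℝ}

lemma one_le_price (hβ : 0 < β) (hβb : β ≤ b) : 1 ≤ price d b n β := by
  have := sub_nonneg.2 hβb
  exact le_add_of_nonneg_right (mul_nonneg (by positivity) (Real.log_natCast_nonneg n))

lemma adaptiveRate_pos (hβ : 0 < β) (hβb : β ≤ b) (hn : 0 < n) : 0 < adaptiveRate d b n β :=
  Real.rpow_pos_of_pos
    (div_pos (zero_lt_one.trans_le (one_le_price hβ hβb)) (Nat.cast_pos.2 hn)) _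

lemma log_adaptiveRate (hβ : 0 < β) (hβb : β ≤ b) (hn : 0 < n) :
    Real.log (adaptiveRate d b n β) =
      β / (2 * β + d) * (Real.log (price d b n β) - Real.log n) := by
  have hp := zero_lt_one.trans_le (one_le_price (d := d) (n := n) hβ hβb)
  rw [adaptiveRate, Real.log_rpow (by positivity), Real.log_div hp.ne' (by positivity)]

lemma noiseLevel_zero_le_adaptiveRate (hd : 0 < d) (hβ : 0 < β) (hβb : β ≤ b) (hn : 0 < n) :
    noiseLevel d b n 0 ≤ adaptiveRate d b n β := by
  have hexp : β / (2 * β + d) ≤ b / (2 * b + d) := by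
    rw [div_le_div_iff₀ (by positivity) (by positivity)]
    nlinarith
  have hprice := mul_nonneg (by positivity : 0 ≤ β / (2 * β + d))
    (Real.log_nonneg (one_le_price (d := d) (n := n) hβ hβb))
  rw [← Real.log_le_log_iff (noiseLevel_pos hn 0) (adaptiveRate_pos hβ hβb hn),
    log_noiseLevel_zero hd hn, log_adaptiveRate hβ hβb hn, mul_sub]
  linarith [mul_le_mul_of_nonneg_right hexp (Real.log_natCast_nonneg n)]

lemma log_noiseLevel_le_of_le_mul_rpow (hn : 0 < n) {B : ℝ} (hB : 0 < B) {j : ℕ}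
    (hj : noiseLevel d b n j ≤ B * bandwidth d b n j ^ β) :
    Real.log (noiseLevel d b n j) ≤ Real.log B + β * Real.log (bandwidth d b n j) := by
  have hh := bandwidth_pos (d := d) (b := b) hn j
  rw [← Real.log_rpow hh, ← Real.log_mul hB.ne' (by positivity)]
  exact Real.log_le_log (noiseLevel_pos hn j) hj

lemma weight_le_mul_price (hd : 0 < d) (hβ : 0 < β) (hβb : β ≤ b) (hn : 0 < n) {B : ℝ}
    (hB : 1 ≤ B) {j : ℕ} (hj : noiseLevel d b n j ≤ B * bandwidth d b n j ^ β) :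
    weight j ≤ (1 + 2 * Real.log B) * price d b n β := by
  have hlogB := Real.log_nonneg hB
  have hlogS := log_noiseLevel_le_of_le_mul_rpow hn (zero_lt_one.trans_le hB) hj
  have hlogw := Real.log_nonneg (one_le_weight j)
  have hlogh : -Real.log (bandwidth d b n j) ≤
      (Real.log n + 2 * Real.log B) / (2 * β + d) := by
    rw [le_div_iff₀ (by positivity)]
    linarith [two_mul_log_noiseLevel (d := d) (b := b) hn j]
  have hprice : (Real.log n + 2 * Real.log B) / (2 * β + d) - Real.log n / (2 * b + d) + 1 =
      price d b n β + 2 * Real.log B / (2 * β + d) := by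
    unfold price
    field_simp
    ring
  have hd₁ : (1 : ℝ) ≤ d := Nat.one_le_cast.2 hd
  have hdiv : 2 * Real.log B / (2 * β + d) ≤ 2 * Real.log B :=
    div_le_self (by positivity) (by linarith)
  rw [log_bandwidth hn] at hlogh
  nlinarith [one_le_price (d := d) (n := n) hβ hβb]

lemma log_noiseLevel_le_add_log_adaptiveRate (hd : 0 < d) (hβ : 0 < β) (hβb : β ≤ b) (hn : 0 < n)
    {B : ℝ} (hB : 1 ≤ B) {j : ℕ} (hj : noiseLevel d b n j ≤ B * bandwidth d b n j ^ β) :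
    Real.log (noiseLevel d b n j) ≤
      (β * Real.log (1 + 2 * Real.log B) + d * Real.log B) / (2 * β + d) +
        Real.log (adaptiveRate d b n β) := by
  have hlogB := Real.log_nonneg hB
  have hp := zero_lt_one.trans_le (one_le_price (d := d) (n := n) hβ hβb)
  have hlogw : Real.log (weight j) ≤
      Real.log (1 + 2 * Real.log B) + Real.log (price d b n β) := by
    rw [← Real.log_mul (by positivity) hp.ne']
    exact Real.log_le_log (zero_lt_one.trans_le (one_le_weight j))
      (weight_le_mul_price hd hβ hβb hn hB hj)
  have hlogS := log_noiseLevel_le_of_le_mul_rpow hn (zero_lt_one.trans_le hB) hj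
  have hlogS₂ := two_mul_log_noiseLevel (d := d) (b := b) hn j
  rw [log_adaptiveRate hβ hβb hn, div_mul_eq_mul_div, ← add_div, le_div_iff₀ (by positivity)]
  have hdlogS := mul_le_mul_of_nonneg_left hlogS (by positivity : (0 : ℝ) ≤ d)
  linear_combination β * hlogS₂ + β * hlogw + hdlogS

/-- The ideal index: the first one at which the bias is dominated by the noise level. -/
noncomputable def idealIdx (d b n : ℕ) (β L : ℝ) : ℕ :=
  sInf {k | L * (d * bandwidth d b n k / 2) ^ β ≤ noiseLevel d b n k / 2}

lemma bias_le_of_idealIdx_le (hn : 0 < n) {L : ℝ} (hβ : 0 < β) (hL : 0 < L) {k₀ : ℕ}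
    (hk₀ : L * (d * bandwidth d b n k₀ / 2) ^ β ≤ noiseLevel d b n k₀ / 2) {k : ℕ}
    (hk : idealIdx d b n β L ≤ k) :
    L * (d * bandwidth d b n k / 2) ^ β ≤ noiseLevel d b n k / 2 := by
  have hideal : L * (d * bandwidth d b n (idealIdx d b n β L) / 2) ^ β ≤
      noiseLevel d b n (idealIdx d b n β L) / 2 :=
    Nat.sInf_mem (s := {k | L * (d * bandwidth d b n k / 2) ^ β ≤ noiseLevel d b n k / 2})
      ⟨k₀, hk₀⟩
  have hbw := bandwidth_anti (d := d) (b := b) hn hk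
  have hpos := bandwidth_pos (d := d) (b := b) hn k
  calc L * (d * bandwidth d b n k / 2) ^ β
      ≤ L * (d * bandwidth d b n (idealIdx d b n β L) / 2) ^ β := by gcongr
    _ ≤ noiseLevel d b n (idealIdx d b n β L) / 2 := hideal
    _ ≤ noiseLevel d b n k / 2 := by
        gcongr
        exact noiseLevel_mono hn hk

lemma exists_noiseLevel_idealIdx_le (hd : 0 < d) {L : ℝ} (hβ : 0 < β) (hβb : β ≤ b) :
    ∃ A : ℝ, 0 ≤ A ∧ ∀ n : ℕ, 0 < n →
      noiseLevel d b n (idealIdx d b n β L) ≤ A * adaptiveRate d b n β := by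
  set B := max 1 (2 * (L * (d / 2) ^ β))
  set A := Real.exp ((β * Real.log (1 + 2 * Real.log B) + d * Real.log B) / (2 * β + d))
  refine ⟨1 + 2 ^ (d + 1) * A, by positivity, fun n hn => ?_⟩
  have hφ := adaptiveRate_pos (d := d) hβ hβb hn
  rcases hidx : idealIdx d b n β L with _ | j
  · refine (noiseLevel_zero_le_adaptiveRate hd hβ hβb hn).trans ?_
    exact le_mul_of_one_le_left hφ.le (le_add_of_nonneg_right (by positivity))
  have hnot : noiseLevel d b n j / 2 < L * (d * bandwidth d b n j / 2) ^ β := by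
    by_contra! hmem
    exact (Nat.lt_succ_self j).not_ge (hidx.symm.trans_le (Nat.sInf_le hmem))
  have hj : noiseLevel d b n j ≤ B * bandwidth d b n j ^ β := by
    have hh := bandwidth_pos (d := d) (b := b) hn j
    rw [mul_div_right_comm, Real.mul_rpow (by positivity) hh.le] at hnot
    calc noiseLevel d b n j ≤ 2 * (L * (d / 2) ^ β) * bandwidth d b n j ^ β := by linarith
      _ ≤ B * bandwidth d b n j ^ β := by gcongr; exact le_max_right _ _
  have hrate : noiseLevel d b n j ≤ A * adaptiveRate d b n β := by
    rw [← Real.log_le_log_iff (noiseLevel_pos hn j) (by positivity),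
      Real.log_mul (Real.exp_pos _).ne' hφ.ne', Real.log_exp]
    exact log_noiseLevel_le_add_log_adaptiveRate hd hβ hβb hn (le_max_left _ _) hj
  calc noiseLevel d b n (j + 1) ≤ 2 ^ (d + 1) * noiseLevel d b n j := noiseLevel_succ_le hn j
    _ ≤ 2 ^ (d + 1) * (A * adaptiveRate d b n β) := by gcongr
    _ ≤ (1 + 2 ^ (d + 1) * A) * adaptiveRate d b n β := by linarith

lemma noiseLevel_succ_mul_exp_le (hd : 0 < d) (hn : 0 < n) (j : ℕ) :
    noiseLevel d b n (j + 1) * Real.exp (-(9 / 16 * d * weight j)) ≤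
      4 * noiseLevel d b n 0 * Real.exp (-(Real.log 2 / 32)) ^ j := by
  have hd₁ : (1 : ℝ) ≤ d := Nat.one_le_cast.2 hd
  have hS₀ := noiseLevel_nonneg (d := d) (b := b) (n := n) 0
  have hw : weight (j + 1) ≤ 16 * Real.exp (weight (j + 1) / 16) := by
    linarith [Real.add_one_le_exp (weight (j + 1) / 16)]
  have hexponent : weight (j + 1) / 16 + d * (weight (j + 1) - 1) - 9 / 8 * d * weight j ≤
      -(j * (Real.log 2 / 16)) := by
    have hj : j * Real.log 2 = weight j - 1 := (add_sub_cancel_left _ _).symm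
    rw [weight_succ]
    nlinarith [Real.log_two_lt_d9, one_le_weight j]
  refine le_of_sq_le_sq ?_ (by positivity)
  rw [mul_pow, noiseLevel_sq_eq_mul_noiseLevel_zero_sq hn (j + 1)]
  calc weight (j + 1) * Real.exp (d * (weight (j + 1) - 1)) * noiseLevel d b n 0 ^ 2 *
        Real.exp (-(9 / 16 * d * weight j)) ^ 2
      ≤ 16 * Real.exp (weight (j + 1) / 16) * Real.exp (d * (weight (j + 1) - 1)) *
        noiseLevel d b n 0 ^ 2 * Real.exp (-(9 / 16 * d * weight j)) ^ 2 := by gcongr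
    _ = 16 * noiseLevel d b n 0 ^ 2 * Real.exp (weight (j + 1) / 16 +
        d * (weight (j + 1) - 1) - 9 / 8 * d * weight j) := by
      rw [← Real.exp_nat_mul, sub_eq_add_neg _ (9 / 8 * d * weight j), Real.exp_add, Real.exp_add]
      ring_nf
    _ ≤ 16 * noiseLevel d b n 0 ^ 2 * Real.exp (-(j * (Real.log 2 / 16))) := by gcongr
    _ = (4 * noiseLevel d b n 0 * Real.exp (-(Real.log 2 / 32)) ^ j) ^ 2 := by
      rw [mul_pow, mul_pow, ← Real.exp_nat_mul, ← Real.exp_nat_mul]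
      ring_nf

lemma exists_sum_noiseLevel_mul_exp_rpow_le (hd : 0 < d) (b : ℕ) {r : ℝ} (hr : 0 < r) :
    ∃ A : ℝ, 0 ≤ A ∧ ∀ n : ℕ, 0 < n → ∀ s : Finset ℕ,
      ∑ j ∈ s, (noiseLevel d b n (j + 1) * Real.exp (-(9 / 16 * d * weight j))) ^ r ≤
        A * noiseLevel d b n 0 ^ r := by
  set q := Real.exp (-(Real.log 2 / 32)) ^ r
  have hq₀ : 0 ≤ q := Real.rpow_nonneg (Real.exp_pos _).le _
  have hq₁ : q < 1 := Real.rpow_lt_one (Real.exp_pos _).le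
    (Real.exp_lt_one_iff.2 (neg_neg_of_pos (div_pos (Real.log_pos one_lt_two) (by norm_num)))) hr
  refine ⟨4 ^ r * (1 - q)⁻¹, mul_nonneg (by positivity) (inv_nonneg.2 (sub_nonneg.2 hq₁.le)),
    fun n hn s => ?_⟩
  have hS₀ := noiseLevel_nonneg (d := d) (b := b) (n := n) 0
  have hterm (j : ℕ) : (noiseLevel d b n (j + 1) * Real.exp (-(9 / 16 * d * weight j))) ^ r ≤
      4 ^ r * noiseLevel d b n 0 ^ r * q ^ j := by
    rw [← Real.mul_rpow (by positivity) hS₀, Real.rpow_pow_comm (Real.exp_pos _).le,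
      ← Real.mul_rpow (by positivity) (by positivity)]
    exact Real.rpow_le_rpow (mul_nonneg (noiseLevel_nonneg _) (Real.exp_pos _).le)
      (noiseLevel_succ_mul_exp_le hd hn j) hr.le
  calc ∑ j ∈ s, (noiseLevel d b n (j + 1) * Real.exp (-(9 / 16 * d * weight j))) ^ r
      ≤ 4 ^ r * noiseLevel d b n 0 ^ r * ∑ j ∈ s, q ^ j := by
        rw [Finset.mul_sum]
        exact Finset.sum_le_sum fun j _ => hterm j
    _ ≤ 4 ^ r * noiseLevel d b n 0 ^ r * (1 - q)⁻¹ := by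
        rw [← tsum_geometric_of_lt_one hq₀ hq₁]
        gcongr
        exact (summable_geometric_of_lt_one hq₀ hq₁).sum_le_tsum s fun _ _ => by positivity
    _ = 4 ^ r * (1 - q)⁻¹ * noiseLevel d b n 0 ^ r := by ring

end Rate

/-! ### Lepski's selection rule -/

section Lepski

variable {d b n : ℕ} {θ : (n : ℕ) → ℝ → Sample d n → Coef d b} {C a : ℝ}

lemma abs_lepskiEst_sub_le (hC : 0 ≤ C) (hn : 0 < n) {Z : Sample d n} {J : ℕ}
    (hJ : J ≤ lastIdx d b n) (haccurate : ∀ l, J ≤ l → l ≤ lastIdx d b n →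
      |lpa θ l Z - a| ≤ C / 2 * noiseLevel d b n l) :
    |lepskiEst C θ n Z - a| ≤ 3 / 2 * C * noiseLevel d b n J := by
  have haccurateJ := haccurate J le_rfl hJ
  have hJ_adm : J ∈ {k : ℕ | k ≤ lastIdx d b n ∧ ∀ l, k + 1 ≤ l → l ≤ lastIdx d b n →
      |lpa θ k Z - lpa θ l Z| ≤ C * noiseLevel d b n l} := by
    refine ⟨hJ, fun l hJl hl => ?_⟩
    have hmono : C / 2 * noiseLevel d b n J ≤ C / 2 * noiseLevel d b n l := by
      gcongr
      exact noiseLevel_mono hn (by lia)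
    have htri := abs_sub_le (lpa θ J Z) a (lpa θ l Z)
    rw [abs_sub_comm a] at htri
    linarith [haccurate l (by lia) hl]
  change |lpa θ (selIdx C θ Z) Z - a| ≤ _
  rcases (Nat.sInf_le hJ_adm).lt_or_eq with hlt | heq
  · have hsel : |lpa θ (selIdx C θ Z) Z - lpa θ J Z| ≤ C * noiseLevel d b n J :=
      (Nat.sInf_mem ⟨J, hJ_adm⟩).2 J hlt hJ
    linarith [abs_sub_le (lpa θ (selIdx C θ Z) Z) (lpa θ J Z) a]
  · rw [show selIdx C θ Z = J from heq]
    linarith [mul_nonneg hC (noiseLevel_nonneg (d := d) (b := b) (n := n) J)]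

/-- The event that the estimator at the `l`-th bandwidth misses the target `a` by more than half
of Lepski's threshold. -/
def missEvent (C : ℝ) (θ : (n : ℕ) → ℝ → Sample d n → Coef d b) (n : ℕ) (a : ℝ) (l : ℕ) :
    Set (Sample d n) :=
  {Z | C / 2 * noiseLevel d b n l < |lpa θ l Z - a|}

lemma measurableSet_missEvent {l : ℕ} (hθ : Measurable (lpa θ l : Sample d n → ℝ)) :
    MeasurableSet (missEvent C θ n a l) :=
  measurableSet_lt measurable_const (hθ.sub_const a).abs

-- Split according to the last index at which the estimator misses its target.
lemma ofReal_abs_lepskiEst_sub_rpow_le (hC : 0 ≤ C) (hn : 0 < n) {B r : ℝ} (hr : 0 ≤ r) {k : ℕ}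
    (hk : k ≤ lastIdx d b n) {Z : Sample d n} (hB : |lepskiEst C θ n Z - a| ≤ B) :
    ENNReal.ofReal (|lepskiEst C θ n Z - a| ^ r) ≤
      ENNReal.ofReal ((3 / 2 * C * noiseLevel d b n k) ^ r) +
      ∑ j ∈ Finset.Ico k (lastIdx d b n), (missEvent C θ n a j).indicator
        (fun _ => ENNReal.ofReal ((3 / 2 * C * noiseLevel d b n (j + 1)) ^ r)) Z +
      (missEvent C θ n a (lastIdx d b n)).indicator (fun _ => ENNReal.ofReal (B ^ r)) Z := by
  classical
  have hmono {x : ℝ} (hx : |lepskiEst C θ n Z - a| ≤ x) :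
      ENNReal.ofReal (|lepskiEst C θ n Z - a| ^ r) ≤ ENNReal.ofReal (x ^ r) := by gcongr
  by_cases hmiss : ∃ l, k ≤ l ∧ l ≤ lastIdx d b n ∧ Z ∈ missEvent C θ n a l
  swap
  · push Not at hmiss
    exact (hmono (abs_lepskiEst_sub_le hC hn hk fun l hkl hl => not_lt.1 (hmiss l hkl hl))).trans
      (le_add_right (le_add_right le_rfl))
  obtain ⟨l, hkl, hl, hZl⟩ := hmiss
  set j := Nat.findGreatest (Z ∈ missEvent C θ n a ·) (lastIdx d b n)
  have hj : j ≤ lastIdx d b n := Nat.findGreatest_le _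
  have hZj : Z ∈ missEvent C θ n a j :=
    Nat.findGreatest_spec (P := (Z ∈ missEvent C θ n a ·)) hl hZl
  have hkj : k ≤ j :=
    hkl.trans (Nat.le_findGreatest (P := (Z ∈ missEvent C θ n a ·)) hl hZl)
  rcases hj.lt_or_eq with hlt | heq
  · have hacc : |lepskiEst C θ n Z - a| ≤ 3 / 2 * C * noiseLevel d b n (j + 1) :=
      abs_lepskiEst_sub_le hC hn hlt fun l hjl hl =>
        not_lt.1 (Nat.findGreatest_is_greatest (P := (Z ∈ missEvent C θ n a ·)) hjl hl)
    refine (hmono hacc).trans (le_add_right (le_add_left ?_))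
    refine le_of_eq_of_le ?_ (Finset.single_le_sum (fun _ _ => zero_le)
      (Finset.mem_Ico.2 ⟨hkj, hlt⟩))
    rw [indicator_of_mem hZj]
  · rw [← heq, indicator_of_mem hZj]
    exact (hmono hB).trans (le_add_left le_rfl)

lemma lintegral_lepskiEst_le (hC : 0 ≤ C) (hn : 0 < n) {μ : Measure (Sample d n)}
    [IsProbabilityMeasure μ] (hθ : ∀ k, Measurable (lpa θ k : Sample d n → ℝ)) {B r : ℝ}
    (hr : 0 ≤ r) (hB₀ : 0 ≤ B) (hB : ∀ Z : Sample d n, |lepskiEst C θ n Z - a| ≤ B) {k : ℕ}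
    (hk : k ≤ lastIdx d b n) :
    ∫⁻ Z, ENNReal.ofReal (|lepskiEst C θ n Z - a| ^ r) ∂μ ≤
      ENNReal.ofReal ((3 / 2 * C * noiseLevel d b n k) ^ r +
        ∑ j ∈ Finset.Ico k (lastIdx d b n), (3 / 2 * C * noiseLevel d b n (j + 1)) ^ r *
          μ.real (missEvent C θ n a j) +
        B ^ r * μ.real (missEvent C θ n a (lastIdx d b n))) := by
  have hS (l : ℕ) : 0 ≤ (3 / 2 * C * noiseLevel d b n l) ^ r := by
    have := noiseLevel_nonneg (d := d) (b := b) (n := n) l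
    positivity
  have hevent {y : ℝ} (hy : 0 ≤ y) (l : ℕ) :
      ∫⁻ Z, (missEvent C θ n a l).indicator (fun _ => ENNReal.ofReal y) Z ∂μ =
        ENNReal.ofReal (y * μ.real (missEvent C θ n a l)) := by
    rw [lintegral_indicator_const (measurableSet_missEvent (hθ l)), ENNReal.ofReal_mul hy,
      ofReal_measureReal]
  refine (lintegral_mono fun Z => ofReal_abs_lepskiEst_sub_rpow_le hC hn hr hk (hB Z)).trans_eq ?_
  have hterm (j : ℕ) : 0 ≤ (3 / 2 * C * noiseLevel d b n (j + 1)) ^ r *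
      μ.real (missEvent C θ n a j) := mul_nonneg (hS _) measureReal_nonneg
  have hsum := Finset.sum_nonneg fun j (_ : j ∈ Finset.Ico k (lastIdx d b n)) => hterm j
  have hBr := Real.rpow_nonneg hB₀ r
  rw [lintegral_add_right _ (measurable_const.indicator (measurableSet_missEvent (hθ _))),
    lintegral_add_left measurable_const, lintegral_const, measure_univ, mul_one,
    lintegral_finsetSum _ fun j _ => measurable_const.indicator (measurableSet_missEvent (hθ j)),
    hevent hBr, Finset.sum_congr rfl fun j _ => hevent (hS (j + 1)) j,
    ← ENNReal.ofReal_sum_of_nonneg fun j _ => hterm j, ← ENNReal.ofReal_add (hS k) hsum,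
    ← ENNReal.ofReal_add (add_nonneg (hS k) hsum) (mul_nonneg hBr measureReal_nonneg)]

lemma lintegral_lepskiEst_le_of_measureReal_missEvent_le (hC : 0 ≤ C) (hn : 0 < n)
    {μ : Measure (Sample d n)} [IsProbabilityMeasure μ]
    (hθ : ∀ k, Measurable (lpa θ k : Sample d n → ℝ)) {B r : ℝ} (hr : 0 ≤ r) (hB₀ : 0 ≤ B)
    (hB : ∀ Z : Sample d n, |lepskiEst C θ n Z - a| ≤ B) {k : ℕ} (hk : k ≤ lastIdx d b n)
    {D : ℝ} {e : ℕ → ℝ} (he : ∀ l, 0 ≤ e l) (hmiss : ∀ l, k ≤ l → l ≤ lastIdx d b n →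
      μ.real (missEvent C θ n a l) ≤ D * e l ^ r) :
    ∫⁻ Z, ENNReal.ofReal (|lepskiEst C θ n Z - a| ^ r) ∂μ ≤
      ENNReal.ofReal ((3 / 2 * C * noiseLevel d b n k) ^ r +
        D * (3 / 2 * C) ^ r * ∑ j ∈ Finset.Ico k (lastIdx d b n),
          (noiseLevel d b n (j + 1) * e j) ^ r +
        D * B ^ r * e (lastIdx d b n) ^ r) := by
  refine (lintegral_lepskiEst_le hC hn hθ hr hB₀ hB hk).trans (ENNReal.ofReal_le_ofReal ?_)
  rw [Finset.mul_sum]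
  refine add_le_add (add_le_add le_rfl (Finset.sum_le_sum fun j hj => ?_)) ?_
  · have hS := noiseLevel_nonneg (d := d) (b := b) (n := n) (j + 1)
    obtain ⟨hkj, hj⟩ := Finset.mem_Ico.1 hj
    calc (3 / 2 * C * noiseLevel d b n (j + 1)) ^ r * μ.real (missEvent C θ n a j)
        ≤ (3 / 2 * C * noiseLevel d b n (j + 1)) ^ r * (D * e j ^ r) := by
          gcongr
          exact hmiss j hkj hj.le
      _ = D * (3 / 2 * C) ^ r * (noiseLevel d b n (j + 1) * e j) ^ r := by
          rw [Real.mul_rpow (by positivity) hS, Real.mul_rpow hS (he j)]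
          ring
  · calc B ^ r * μ.real (missEvent C θ n a (lastIdx d b n))
        ≤ B ^ r * (D * e (lastIdx d b n) ^ r) := by
          gcongr
          exact hmiss _ hk le_rfl
      _ = D * B ^ r * e (lastIdx d b n) ^ r := by ring

end Lepski

/-! ### Deviations at the selected bandwidths -/

section Deviation

variable {d b n : ℕ} {M : ℝ} {K : (Fin d → ℝ) → ℝ} {x₀ : Fin d → ℝ} {f : (Fin d → ℝ) → ℝ}
  {g : ℝ → ℝ} {σmin γ r : ℝ} {σ : ℕ → ℝ} {θ : (n : ℕ) → ℝ → Sample d n → Coef d b}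

lemma add_smul_mem_cube {z : Fin d → ℝ} (hx₀ : x₀ ∈ cube d) {h₀ h : ℝ} (hh₀ : 0 < h₀)
    (hh : 0 ≤ h) (hle : h ≤ h₀) (hz : x₀ + h₀ • z ∈ cube d) : x₀ + h • z ∈ cube d := by
  have hmem : h / h₀ ∈ Icc (0 : ℝ) 1 := ⟨div_nonneg hh hh₀.le, (div_le_one hh₀).2 hle⟩
  simpa only [add_sub_cancel_left, smul_smul, div_mul_cancel₀ _ hh₀.ne'] using
    (show Convex ℝ (cube d) from convex_Icc _ _).add_smul_sub_mem hx₀ hz hmem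

lemma one_le_numIdx (d b : ℕ) : 1 ≤ numIdx d b :=
  Finset.card_pos.2 ⟨0, zero_mem_multiIdx d b⟩

lemma abs_apply_le_of_mem_paramSet {t : Coef d b} (ht : t ∈ paramSet d b M)
    (p : ↥(multiIdx d b)) : |t p| ≤ M :=
  (Finset.single_le_sum (f := fun p => |t p|) (fun _ _ => abs_nonneg _) (Finset.mem_univ p)).trans
    ht

lemma threshold_pos (hK : IsKernel K) (hc : 0 < huberConst g σmin γ) :
    0 < threshold d b K g σmin γ r := by
  have := hK.minEig_pos b
  have : (0 : ℝ) < numIdx d b := Nat.cast_pos.2 (one_le_numIdx d b)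
  have := zero_lt_one.trans_le hK.one_le_kerSup
  have : 0 < ∫ z in (0 : ℝ)..(γ * σmin), g z := pos_of_mul_pos_right hc zero_le_two
  unfold threshold
  positivity

/-- The deviation of the score, in multiples of the noise level, which the threshold constant
allows for. -/
noncomputable def scoreDev (K : (Fin d → ℝ) → ℝ) (γ r : ℝ) : ℝ :=
  3 / 2 * kerSup K * max 1 γ * Real.sqrt (r * d)

lemma IsKernel.scoreDev_nonneg (hK : IsKernel K) : 0 ≤ scoreDev K γ r := by
  have := zero_le_one.trans hK.one_le_kerSup
  unfold scoreDev
  positivity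

lemma curvature_mul_half_threshold (hK : IsKernel K) (hc : 0 < huberConst g σmin γ) :
    3 / 8 * (huberConst g σmin γ * minEig d b K) * (threshold d b K g σmin γ r / 2) =
      numIdx d b * (3 / 4 + scoreDev K γ r) := by
  have := hK.minEig_pos b
  have : 0 < ∫ z in (0 : ℝ)..(γ * σmin), g z := pos_of_mul_pos_right hc zero_le_two
  rw [huberConst, threshold, scoreDev]
  field_simp
  ring

lemma IsKernel.mul_weight_le_scoreDev (hK : IsKernel K) (hγ : 0 < γ) (hr : 0 ≤ r) (l : ℕ) :
    9 / 16 * d * weight l * r ≤ scoreDev K γ r ^ 2 * weight l / (4 * (γ ^ 2 * kerSup K)) := by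
  have hK₁ := hK.one_le_kerSup
  have := zero_lt_one.trans_le hK₁
  have hw := zero_le_one.trans (one_le_weight l)
  have hγ_max : γ ^ 2 ≤ max 1 γ ^ 2 := by
    gcongr
    exact le_max_right _ _
  rw [le_div_iff₀ (by positivity), scoreDev, mul_pow, Real.sq_sqrt (by positivity)]
  calc 9 / 16 * d * weight l * r * (4 * (γ ^ 2 * kerSup K))
      = 9 / 4 * (r * d) * weight l * (γ ^ 2 * kerSup K) := by ring
    _ ≤ 9 / 4 * (r * d) * weight l * (max 1 γ ^ 2 * kerSup K ^ 2) := by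
        gcongr
        exact le_self_pow₀ hK₁ two_ne_zero
    _ = (3 / 2 * kerSup K * max 1 γ) ^ 2 * (r * d) * weight l := by ring

lemma measureReal_missEvent_le (hK : IsKernel K) (hg : IsSymmDensity g) (hσ : ∀ i, 0 < σ i)
    (hγ : 0 < γ) (hc : 0 < huberConst g σmin γ)
    (hG : scaledDensity g σ ∈ densityClass (huber γ) (huberConst g σmin γ))
    (hθ : IsMinimizer (huber γ) K x₀ M θ) (hr : 0 ≤ r) (hn : 0 < n)
    (hf : AEMeasurable f (volume.restrict (cube d))) {l : ℕ}
    (hKh : ∀ z, K z ≠ 0 → x₀ + bandwidth d b n l • z ∈ cube d) {B : ℝ}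
    (hB : B ≤ noiseLevel d b n l / 2) {t : Coef d b} (ht : t ∈ paramSet d b M)
    (ht₀ : t ⟨0, zero_mem_multiIdx d b⟩ = f x₀)
    (htB : ∀ x ∈ nbhd x₀ (bandwidth d b n l),
      |f x - locPoly x₀ (bandwidth d b n l) t x| ≤ B)
    (hS : noiseLevel d b n l *
      (8 + scoreDev K γ r + 8 * (numIdx d b * threshold d b K g σmin γ r)) ≤ γ)
    {η : ℝ} (hη : 0 ≤ η) (hη₁ : η ≤ 1)
    (hηc : numIdx d b * η ≤ huberConst g σmin γ * minEig d b K / 8)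
    (hηw : 9 / 16 * d * weight l * r ≤ n * bandwidth d b n l ^ d * η ^ 2 / (4 * kerSup K)) :
    (obsLaw g σ f n).real (missEvent (threshold d b K g σmin γ r) θ n (f x₀) l) ≤
      (2 * numIdx d b + 2 * numIdx d b ^ 2) * Real.exp (-(9 / 16 * d * weight l)) ^ r := by
  have := isProbabilityMeasure_obsLaw (σ := σ) (n := n) hg hf
  have hh := bandwidth_mem_Ioc (d := d) (b := b) hn l
  have hS₀ := noiseLevel_pos (d := d) (b := b) hn l
  have hX := hK.scoreDev_nonneg (γ := γ) (r := r)
  have hC := threshold_pos (b := b) (r := r) hK hc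
  have hN : (0 : ℝ) < numIdx d b := Nat.cast_pos.2 (one_le_numIdx d b)
  have hSX : 0 ≤ noiseLevel d b n l * scoreDev K γ r := by positivity
  have hSC : 0 ≤ noiseLevel d b n l * (numIdx d b * threshold d b K g σmin γ r) := by positivity
  have hbal : numIdx d b * (scoreDev K γ r * noiseLevel d b n l + B) <
      3 / 8 * (huberConst g σmin γ * minEig d b K) *
        (threshold d b K g σmin γ r / 2 * noiseLevel d b n l) := by
    rw [← mul_assoc, curvature_mul_half_threshold hK hc, mul_assoc]
    gcongr
    linarith
  have hlocal := measureReal_local_error_le hK hh.1 hKh hg hf hσ hn hγ hc.le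
    (hg.le_integral_of_scaledDensity_mem_densityClass hγ hσ hG) htB (by linarith)
    (fun Z => ((hθ n _ hh).2 Z).2 t ht) (mul_nonneg hX hS₀.le) (by linarith)
    (mul_pos (half_pos hC) hS₀) (by linarith) hη hη₁ hηc hbal ⟨0, zero_mem_multiIdx d b⟩
  have hscore : 9 / 16 * d * weight l * r ≤ n * bandwidth d b n l ^ d *
      (scoreDev K γ r * noiseLevel d b n l) ^ 2 / (4 * (γ ^ 2 * kerSup K)) :=
    (hK.mul_weight_le_scoreDev hγ hr l).trans_eq (by
      rw [← mul_noiseLevel_sq (d := d) (b := b) hn l]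
      ring)
  rw [ht₀] at hlocal
  have hsub : missEvent (threshold d b K g σmin γ r) θ n (f x₀) l ⊆
      {Z | threshold d b K g σmin γ r / 2 * noiseLevel d b n l ≤ |lpa θ l Z - f x₀|} :=
    fun Z (hZ : _ < |lpa θ l Z - f x₀|) => hZ.le
  calc _ ≤ _ := (measureReal_mono hsub).trans hlocal
    _ ≤ numIdx d b * (2 * Real.exp (-(9 / 16 * d * weight l * r))) +
          numIdx d b ^ 2 * (2 * Real.exp (-(9 / 16 * d * weight l * r))) := by gcongr
    _ = _ := by
        rw [← Real.exp_mul, neg_mul]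
        ring

lemma eventually_measureReal_missEvent_le (hd : 0 < d) (hb : 0 < b) (hM : 0 ≤ M)
    (hK : IsKernel K) (hx₀ : x₀ ∈ cube d)
    (hKx₀ : ∃ h₀ : ℝ, 0 < h₀ ∧ ∀ z, K z ≠ 0 → x₀ + h₀ • z ∈ cube d) (hg : IsSymmDensity g)
    (hσ : ∀ i, 0 < σ i) (hγ : 0 < γ) (hc : 0 < huberConst g σmin γ)
    (hG : scaledDensity g σ ∈ densityClass (huber γ) (huberConst g σmin γ))
    (hθ : IsMinimizer (huber γ) K x₀ M θ) {β L : ℝ} (hβ : 0 < β) (hβb : β ≤ b) (hL : 0 < L)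
    (hr : 0 < r) :
    ∀ᶠ n : ℕ in atTop, ∀ f ∈ holderClass d β L M,
      ∀ l, idealIdx d b n β L ≤ l → l ≤ lastIdx d b n →
        (obsLaw g σ f n).real (missEvent (threshold d b K g σmin γ r) θ n (f x₀) l) ≤
          (2 * numIdx d b + 2 * numIdx d b ^ 2) * Real.exp (-(9 / 16 * d * weight l)) ^ r := by
  obtain ⟨h₀, hh₀, hKh₀⟩ := hKx₀
  have hC := threshold_pos (b := b) (r := r) hK hc
  have hX := hK.scoreDev_nonneg (γ := γ) (r := r)
  have hlam := hK.minEig_pos b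
  have hK₀ := zero_lt_one.trans_le hK.one_le_kerSup
  have hN : (0 : ℝ) < numIdx d b := Nat.cast_pos.2 (one_le_numIdx d b)
  set η := min 1 (huberConst g σmin γ * minEig d b K / 8 / numIdx d b)
  have hη : 0 < η := lt_min one_pos (by positivity)
  have hdr : 0 < 9 / 16 * d * r := by positivity
  filter_upwards [eventually_weight_le hd hb
      (div_pos (div_pos (pow_pos hη 2) (mul_pos four_pos hK₀)) hdr),
    eventually_noiseLevel_le hd hb (div_pos hγ (by positivity :
      0 < 8 + scoreDev K γ r + 8 * (numIdx d b * threshold d b K g σmin γ r))),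
    eventually_hMax_le hd hh₀, eventually_bias_lastIdx_le hd hb hβ hL, eventually_gt_atTop 0]
    with n hweight hnoise hmax hbias hn f hf l hkl hl
  have hh := bandwidth_mem_Ioc (d := d) (b := b) hn l
  obtain ⟨t, ht, ht₀, htB⟩ := exists_abs_sub_locPoly_le hβ hβb hL.le hM hx₀ hf hh.1 hh.2
  refine measureReal_missEvent_le hK hg hσ hγ hc hG hθ hr.le hn
    ((continuousOn_of_mem_holderClass hβ hL.le hM hf).aemeasurable (measurableSet_cube d))
    (fun z hz => add_smul_mem_cube hx₀ hh₀ hh.1.le ((bandwidth_le_hMax hn l).trans hmax)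
      (hKh₀ z hz)) (bias_le_of_idealIdx_le hn hβ hL hbias hkl) ht ht₀ htB
    ((le_div_iff₀ (by positivity)).1 (hnoise l hl)) hη.le (min_le_left _ _)
    ((le_div_iff₀' hN).1 (min_le_right _ _)) ?_
  calc 9 / 16 * d * weight l * r = 9 / 16 * d * r * weight l := by ring
    _ ≤ 9 / 16 * d * r * (η ^ 2 / (4 * kerSup K) / (9 / 16 * d * r) *
        (n * bandwidth d b n l ^ d)) := by gcongr; exact hweight l hl
    _ = n * bandwidth d b n l ^ d * η ^ 2 / (4 * kerSup K) := by field_simp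

end Deviation

/-! ### The maximal risk -/

section Risk

variable {d b n : ℕ} {M : ℝ} {K : (Fin d → ℝ) → ℝ} {x₀ : Fin d → ℝ} {g : ℝ → ℝ}
  {σmin γ r : ℝ} {σ : ℕ → ℝ} {θ : (n : ℕ) → ℝ → Sample d n → Coef d b}

lemma IsMinimizer.measurable_lpa {ρ : ℝ → ℝ} (hθ : IsMinimizer ρ K x₀ M θ) (hn : 0 < n) (l : ℕ) :
    Measurable (lpa θ l : Sample d n → ℝ) :=
  (measurable_pi_apply _).comp (hθ n _ (bandwidth_mem_Ioc hn l)).1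

lemma IsMinimizer.abs_lepskiEst_le {ρ : ℝ → ℝ} (hθ : IsMinimizer ρ K x₀ M θ) (hn : 0 < n) (C : ℝ)
    (Z : Sample d n) : |lepskiEst C θ n Z| ≤ M :=
  abs_apply_le_of_mem_paramSet
    ((hθ n _ (bandwidth_mem_Ioc (d := d) (b := b) hn (selIdx C θ Z))).2 Z).1 _

lemma IsMinimizer.nonneg {ρ : ℝ → ℝ} (hθ : IsMinimizer ρ K x₀ M θ) : 0 ≤ M :=
  (Finset.sum_nonneg fun _ _ => abs_nonneg _).trans
    ((hθ 0 1 ⟨one_pos, le_rfl⟩).2 fun i => i.elim0).1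

lemma abs_le_of_mem_holderClass {β L : ℝ} (hβ : 0 < β) (hL : 0 ≤ L) (hM : 0 ≤ M)
    (hx₀ : x₀ ∈ cube d) {f : (Fin d → ℝ) → ℝ} (hf : f ∈ holderClass d β L M) : |f x₀| ≤ M := by
  obtain ⟨t, ht, ht₀, -⟩ :=
    exists_abs_sub_locPoly_le hβ (Nat.le_ceil β) hL hM hx₀ hf one_pos le_rfl
  rw [← ht₀]
  exact abs_apply_le_of_mem_paramSet ht _

lemma exists_maxRisk_le (hd : 0 < d) (hb : 0 < b) (hM : 0 ≤ M) (hK : IsKernel K)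
    (hx₀ : x₀ ∈ cube d)
    (hKx₀ : ∃ h₀ : ℝ, 0 < h₀ ∧ ∀ z, K z ≠ 0 → x₀ + h₀ • z ∈ cube d) (hg : IsSymmDensity g)
    (hσ : ∀ i, 0 < σ i) (hγ : 0 < γ) (hc : 0 < huberConst g σmin γ)
    (hG : scaledDensity g σ ∈ densityClass (huber γ) (huberConst g σmin γ))
    (hθ : IsMinimizer (huber γ) K x₀ M θ) {β L : ℝ} (hβ : 0 < β) (hβb : β ≤ b) (hL : 0 < L)
    (hr : 0 < r) :
    ∃ R : ℝ, ∀ᶠ n : ℕ in atTop,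
      maxRisk g σ x₀ r n (lepskiEst (threshold d b K g σmin γ r) θ n) (holderClass d β L M) ≤
        ENNReal.ofReal (R * adaptiveRate d b n β ^ r) := by
  obtain ⟨A₁, hA₁, hideal⟩ := exists_noiseLevel_idealIdx_le (b := b) (L := L) hd hβ hβb
  obtain ⟨A₂, hA₂, hsum⟩ := exists_sum_noiseLevel_mul_exp_rpow_le hd b hr
  have hC := threshold_pos (b := b) (r := r) hK hc
  set C := threshold d b K g σmin γ r
  set D : ℝ := 2 * numIdx d b + 2 * numIdx d b ^ 2
  refine ⟨(3 / 2 * C * A₁) ^ r + D * (3 / 2 * C) ^ r * A₂ + D * (M + M) ^ r, ?_⟩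
  filter_upwards [eventually_measureReal_missEvent_le hd hb hM hK hx₀ hKx₀ hg hσ hγ hc hG hθ hβ
      hβb hL hr, eventually_bias_lastIdx_le hd hb hβ hL, eventually_exp_weight_lastIdx_le hd hb,
    eventually_gt_atTop 0] with n hmiss hbias hexp hn
  have hφ := adaptiveRate_pos (d := d) hβ hβb hn
  have hS₀φ := noiseLevel_zero_le_adaptiveRate hd hβ hβb hn
  have hS (l : ℕ) := noiseLevel_nonneg (d := d) (b := b) (n := n) l
  have hk : idealIdx d b n β L ≤ lastIdx d b n := Nat.sInf_le hbias
  refine iSup₂_le fun f hf => ?_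
  have := isProbabilityMeasure_obsLaw (σ := σ) (n := n) hg
    ((continuousOn_of_mem_holderClass hβ hL.le hM hf).aemeasurable (measurableSet_cube d))
  have hbound (Z : Sample d n) : |lepskiEst C θ n Z - f x₀| ≤ M + M :=
    (abs_sub _ _).trans (add_le_add (hθ.abs_lepskiEst_le hn C Z)
      (abs_le_of_mem_holderClass hβ hL.le hM hx₀ hf))
  refine (lintegral_lepskiEst_le_of_measureReal_missEvent_le hC.le hn (hθ.measurable_lpa hn) hr.le
    (by positivity) hbound hk (fun _ => (Real.exp_pos _).le) (hmiss f hf)).trans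
      (ENNReal.ofReal_le_ofReal ?_)
  have := hS (idealIdx d b n β L)
  have := hS 0
  calc _ ≤ (3 / 2 * C * (A₁ * adaptiveRate d b n β)) ^ r +
        D * (3 / 2 * C) ^ r * (A₂ * adaptiveRate d b n β ^ r) +
        D * (M + M) ^ r * adaptiveRate d b n β ^ r := by
        gcongr
        · exact hideal n hn
        · exact (hsum n hn _).trans (by gcongr)
        · exact hexp.trans hS₀φ
    _ = _ := by
        rw [← mul_assoc (3 / 2 * C), Real.mul_rpow (by positivity) hφ.le]
        ring

end Risk

end HuberLepski

theorem corollary1_general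
    (d b : ℕ) (hd : 0 < d) (M : ℝ)
    (K : (Fin d → ℝ) → ℝ) (hK : IsKernel K)
    (x₀ : Fin d → ℝ) (hx₀ : x₀ ∈ cube d)
    (hKx₀ : ∃ h₀ : ℝ, 0 < h₀ ∧ ∀ z, K z ≠ 0 → x₀ + h₀ • z ∈ cube d)
    (g : ℝ → ℝ) (hg : IsSymmDensity g)
    (σmin : ℝ) (σ : ℕ → ℝ) (hσ : ∀ i, 0 < σ i)
    (γ₀ : ℝ) (hγ₀ : 0 < γ₀) (hc : 0 < huberConst g σmin γ₀)
    (hG : scaledDensity g σ ∈ densityClass (huber γ₀) (huberConst g σmin γ₀))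
    (θ : (n : ℕ) → ℝ → Sample d n → Coef d b) (hθ : IsMinimizer (huber γ₀) K x₀ M θ) :
    ∀ β ∈ Ioc (0 : ℝ) b, ∀ L : ℝ, 0 < L → ∀ r : ℝ, 0 < r →
      limsup (fun n : ℕ =>
        ENNReal.ofReal (adaptiveRate d b n β ^ (-r)) *
          maxRisk g σ x₀ r n (lepskiEst (threshold d b K g σmin γ₀ r) θ n)
            (holderClass d β L M)) atTop < ⊤ := by
  rintro β ⟨hβ, hβb⟩ L hL r hr
  have hb : 0 < b := Nat.cast_pos.1 (hβ.trans_le hβb)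
  obtain ⟨R, hR⟩ :=
    exists_maxRisk_le hd hb hθ.nonneg hK hx₀ hKx₀ hg hσ hγ₀ hc hG hθ hβ hβb hL hr
  refine lt_of_le_of_lt (limsup_le_of_le (a := ENNReal.ofReal R) (h := ?_)) ENNReal.ofReal_lt_top
  filter_upwards [hR, eventually_gt_atTop 0] with n hn hn₀
  have hφ := adaptiveRate_pos (d := d) hβ hβb hn₀
  calc _ ≤ ENNReal.ofReal (adaptiveRate d b n β ^ (-r)) *
        ENNReal.ofReal (R * adaptiveRate d b n β ^ r) := by gcongr
    _ = ENNReal.ofReal R := by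
        rw [← ENNReal.ofReal_mul (by positivity), Real.rpow_neg hφ.le]
        congr 1
        field_simp

theorem corollary1
    (d b : ℕ) (hd : 1 ≤ d) (hb : 1 ≤ b) (M : ℝ) (hM : 0 < M)
    (K : (Fin d → ℝ) → ℝ) (hK : IsKernel K)
    (x₀ : Fin d → ℝ) (hx₀ : x₀ ∈ cube d)
    (hKx₀ : ∃ h₀ : ℝ, 0 < h₀ ∧ ∀ z, K z ≠ 0 → x₀ + h₀ • z ∈ cube d)
    (g : ℝ → ℝ) (hg : IsSymmDensity g)
    (σmin : ℝ) (hσmin : 0 < σmin) (σ : ℕ → ℝ) (hσ : ∀ i, σmin ≤ σ i)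
    (γ₀ : ℝ) (hγ₀ : 0 < γ₀) (hc : 0 < huberConst g σmin γ₀)
    (hG : scaledDensity g σ ∈ densityClass (huber γ₀) (huberConst g σmin γ₀))
    (θ : (n : ℕ) → ℝ → Sample d n → Coef d b) (hθ : IsMinimizer (huber γ₀) K x₀ M θ) :
    ∀ β ∈ Ioc (0 : ℝ) b, ∀ L : ℝ, 0 < L → ∀ r : ℝ, 1 ≤ r →
      limsup (fun n : ℕ =>
        ENNReal.ofReal (adaptiveRate d b n β ^ (-r)) *
          maxRisk g σ x₀ r n (lepskiEst (threshold d b K g σmin γ₀ r) θ n)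
            (holderClass d β L M)) atTop < ⊤ := by
  intro β hβ L hL r hr
  exact corollary1_general d b hd M K hK x₀ hx₀ hKx₀ g hg σmin σ (fun i => hσmin.trans_le (hσ i))
    γ₀ hγ₀ hc hG θ hθ β hβ L hL r (zero_lt_one.trans_le hr)
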